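/- **Setting.** In the plane let $\phi_1(\mathbf x)=\tfrac12\mathbf x+(1,\tfrac32)$, $\phi_2(\mathbf x)=\tfrac12\mathbf x+(-\tfrac12,\tfrac32)$, $\Phi(S)=\phi_1(S)\cup\phi_2(S)$, $\Omega(\mathscr T_0)=[0,1]^2\cup\big([-\tfrac12,\tfrac32]\times[1,\tfrac32]\big)$, $\Omega(\mathscr T_n)=\bigcup_{j=0}^n\Phi^j(\Omega(\mathscr T_0))$ with boundary $\mathscr T_n$, and let $\Omega(\mathscr T)=\overline{\bigcup_n\Omega(\mathscr T_n)}$ be the $T$-fractal billiard table. The segments removed in the construction of $\Omega(\mathscr T_{n+1})$ from $\Omega(\mathscr T_n)$ are those whose union is $\Phi^{n+1}([0,1]\times\{0\})$. An orbit $\mathscr O_n=\{(x_n^k,\theta_n^k)\}_{k\ge 0}$ of $\Omega(\mathscr T_n)$ is a forward orbit of the billiard map: $x_n^k$ are the successive collision points with $\mathscr T_n$ and $\theta_n^k$ the inward pointing directions after reflection. (At a vertex with interior angle $\pi/2$ the direction is reversed; at a vertex with interior angle $3\pi/2$ the orbit cannot be continued.) The path of $\mathscr O_n$ is $\bigcup_k[x_n^k,x_n^{k+1}]$.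 For $j\ge1$, the $j$th return time $\upsilon_n^j$ is the $j$th positive $k$ for which $x_n^k$ lies on the side of $\mathscr T_n$ containing $x_n^0$. The first escape time $\tau_n$ is the least positive $k$ for which $x_n^k$ lies on a segment removed in the construction of $\Omega(\mathscr T_{n+1})$. A sequence of orbits $\mathscr O_n$ of $\Omega(\mathscr T_n)$, $n\ge0$, is a *sequence of compatible orbits* if for all $m<n$ the initial directions of $\mathscr O_m$ and $\mathscr O_n$ agree and $x_m^0=x_n^0+sv$ for some $s\ge 0$, where $v$ is the common initial direction and the segment $[x_n^0,x_m^0]$ meets $\mathscr T_n$ only at $x_n^0$. A sequence of compatible orbits with $x_n^0=x^0$ for all $n$ and initial direction $\theta^0$ determines a *recurrent orbit* $\mathscr O(x^0,\theta^0)$ of $\Omega(\mathscr T)$ if for every $j\ge1$ the points $x_n^{\upsilon_n^j}$ converge, as $n\to\infty$, to a point $x^{\upsilon^j}$ of the side containing $x^0$; this is a *periodic orbit* of $\Omega(\mathscr T)$ if the sequence $(x^{\upsilon^j})_{j\ge1}$ is periodic with a finite period. If all $\tau_n$ are finite, the *nontrivial path* of the sequence is $\mathscr N(x^0,\theta^0)=\overline{\bigcup_n\bigcup_{k<\tau_n}[x_n^k,x_n^{k+1}]}$.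 **Theorem.** Let $p\ge1$ be an odd integer, let $x^0=(x_0,0)$ be a point of the base $[0,1]\times\{0\}$ such that $x_0$ is not a dyadic rational ($x_0\ne m2^{-l}$ for all integers $m,l\ge0$), and let $\theta^0\in(0,\pi)$ satisfy $\tan\theta^0=\frac1p$. Then the initial conditions $(x^0,\theta^0)$ and $(x^0,\pi-\theta^0)$ each determine exactly one sequence of compatible orbits of the tables $\Omega(\mathscr T_n)$, $n\ge0$. Let $\mathscr O_n$, $n\ge 0$, be the one for $(x^0,\theta^0)$. Then: 1. every $\mathscr O_n$ is periodic; 2. $\mathscr O(x^0,\theta^0)$ is a periodic orbit of $\Omega(\mathscr T)$; 3. for every $j\ge1$, the return points $x_n^{\upsilon_n^j}$ converge to $x^0$ as $n\to\infty$; 4. both sequences have finite first escape times, so that they yield nontrivial paths $\mathscr N(x^0,\theta^0)$ and $\mathscr N(x^0,\pi-\theta^0)$; these are contained in $\Omega(\mathscr T)$, and the path of $\mathscr O(x^0,\theta^0)$ is their union, that is, the paths of the orbits $\mathscr O_n$ converge to $\mathscr N(x^0,\theta^0)\cup\mathscr N(x^0,\pi-\theta^0)$ in the Hausdorff distance. 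-/

import Mathlib

open Set Filter Topology

/-! The plane is `ℂ` (with its Euclidean metric); a direction is a unit vector of `ℂ`. -/

namespace TFractal

/-! ### The tables -/

/-- The first contraction, `z ↦ z / 2 + (1, 3/2)`. -/
noncomputable def phi₁ (z : ℂ) : ℂ := z / 2 + ⟨1, 3 / 2⟩

/-- The second contraction, `z ↦ z / 2 + (-1/2, 3/2)`. -/
noncomputable def phi₂ (z : ℂ) : ℂ := z / 2 + ⟨-1 / 2, 3 / 2⟩

/-- The action of the iterated function system on sets; its `j`-fold iterate on `S` is the union
of the images of `S` under all compositions of `j` of the two contractions. -/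
def Phi (S : Set ℂ) : Set ℂ := phi₁ '' S ∪ phi₂ '' S

/-- The base of the table: the unit interval on the horizontal axis. -/
def base : Set ℂ := Icc (0 : ℝ) 1 ×ℂ {(0 : ℝ)}

/-- The initial table: a unit square with a `2 × 1/2` rectangle on top of it. -/
def table₀ : Set ℂ :=
  (Icc (0 : ℝ) 1 ×ℂ Icc (0 : ℝ) 1) ∪ (Icc (-1 / 2 : ℝ) (3 / 2) ×ℂ Icc (1 : ℝ) (3 / 2))

/-- The `n`th prefractal table; its boundary is `frontier (table n)`. -/
def table (n : ℕ) : Set ℂ := ⋃ j ∈ Finset.range (n + 1), Phi^[j] table₀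

/-- The `T`-fractal billiard table. -/
def fractalTable : Set ℂ := closure (⋃ n, table n)

/-- The union of the boundary segments of `table n` that are removed when `table (n + 1)` is
constructed: the bases of the copies of `table₀` that are appended in that step. -/
def removed (n : ℕ) : Set ℂ := Phi^[n + 1] base

/-! ### Billiards in a table all of whose sides are horizontal or vertical -/

/-- A basepoint and a direction. -/
abbrev Phase := ℂ × ℂ

/-- `x` lies on a horizontal side (possibly as an endpoint) of the boundary of `Ω`. -/
def OnHorizontalSide (Ω : Set ℂ) (x : ℂ) : Prop :=
  ∃ ε : ℝ, ε ≠ 0 ∧ segment ℝ x (x + (⟨ε, 0⟩ : ℂ)) ⊆ frontier Ω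

/-- `x` lies on a vertical side (possibly as an endpoint) of the boundary of `Ω`. -/
def OnVerticalSide (Ω : Set ℂ) (x : ℂ) : Prop :=
  ∃ ε : ℝ, ε ≠ 0 ∧ segment ℝ x (x + (⟨0, ε⟩ : ℂ)) ⊆ frontier Ω

/-- The directions `v` and `w` at the boundary point `x` are identified in the phase space: they
differ by an element of the group generated by the reflections in the sides containing `x`. -/
def DirEquiv (Ω : Set ℂ) (x : ℂ) : ℂ → ℂ → Prop :=
  Relation.EqvGen fun v w =>
    (OnHorizontalSide Ω x ∧ w = ⟨v.re, -v.im⟩) ∨ (OnVerticalSide Ω x ∧ w = ⟨-v.re, v.im⟩)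

/-- The direction `v` at `x` points into the interior of `Ω`. -/
def Inward (Ω : Set ℂ) (x v : ℂ) : Prop :=
  ∃ ε : ℝ, 0 < ε ∧ ∀ t ∈ Ioo (0 : ℝ) ε, x + t * v ∈ interior Ω

/-- `z'` is the image of `z` under the (partially defined) billiard map of `Ω`. The ball moves
from `z.1` in the direction `z.2` through the interior until it first meets the boundary, at
`z'.1`; the new direction `z'.2` is the only inward direction identified with `z.2` there. (At a
vertex with a reflex interior angle there is more than one such direction and the map is
undefined.) -/
def BilliardStep (Ω : Set ℂ) (z z' : Phase) : Prop :=
  (∃ t : ℝ, 0 < t ∧ z'.1 = z.1 + t * z.2 ∧ z'.1 ∈ frontier Ω ∧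
    ∀ s ∈ Ioo (0 : ℝ) t, z.1 + s * z.2 ∈ interior Ω) ∧
  DirEquiv Ω z'.1 z.2 z'.2 ∧ Inward Ω z'.1 z'.2 ∧
  ∀ w, DirEquiv Ω z'.1 z.2 w → Inward Ω z'.1 w → w = z'.2

/-- `o` is a (nonsingular, forward) billiard orbit of `Ω`: it starts at a boundary point in an
inward direction, and every term is the image of its predecessor under the billiard map. -/
def IsOrbit (Ω : Set ℂ) (o : ℕ → Phase) : Prop :=
  (o 0).1 ∈ frontier Ω ∧ ‖(o 0).2‖ = 1 ∧ Inward Ω (o 0).1 (o 0).2 ∧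
  ∀ k, BilliardStep Ω (o k) (o (k + 1))

/-- The orbit `o` is periodic. -/
def IsPeriodicOrbit (o : ℕ → Phase) : Prop := ∃ m, 0 < m ∧ Function.Periodic o m

/-- The path traced out by the orbit `o`. -/
def orbitPath (o : ℕ → Phase) : Set ℂ := ⋃ k, segment ℝ (o k).1 (o (k + 1)).1

/-- The path traced out by the first `m` steps of the orbit `o`. -/
def initialPath (o : ℕ → Phase) (m : ℕ) : Set ℂ :=
  ⋃ k ∈ Finset.range m, segment ℝ (o k).1 (o (k + 1)).1

/-- The (closed) side of the boundary of `Ω` that contains the boundary point `x` (for a vertex,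
the union of the two sides). -/
def side (Ω : Set ℂ) (x : ℂ) : Set ℂ := {y | segment ℝ x y ⊆ frontier Ω}

/-- `υ j` is, for `j ≥ 1`, the `j`th return time of `o`, that is, the `j`th positive time at which
the orbit is on the side that contains its initial basepoint; moreover `υ 0 = 0`. -/
def IsReturnTimes (Ω : Set ℂ) (o : ℕ → Phase) (υ : ℕ → ℕ) : Prop :=
  υ 0 = 0 ∧ StrictMono υ ∧ ∀ k, (o k).1 ∈ side Ω (o 0).1 ↔ k ∈ range υ

/-- `τ` is the first escape time of an orbit `o` of `table n`, and it is finite. -/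
def IsFirstEscapeTime (n : ℕ) (o : ℕ → Phase) (τ : ℕ) : Prop :=
  IsLeast {k | 0 < k ∧ (o k).1 ∈ removed n} τ

/-! ### Sequences of compatible orbits -/

/-- Compatibility of an initial condition `z` of `table m` and an initial condition `z'` of
`table n`, where `m < n`: the directions agree, and the basepoints lie on a segment in this
direction which meets the boundary of `table n` only at the basepoint of `z'`. -/
def Compatible (n : ℕ) (z z' : Phase) : Prop :=
  z.2 = z'.2 ∧ (∃ s : ℝ, 0 ≤ s ∧ z.1 = z'.1 + s * z'.2) ∧
  segment ℝ z'.1 z.1 ∩ frontier (table n) = {z'.1}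

/-- `O n` (`n = 0, 1, …`) is a sequence of compatible orbits of the tables `table n`. -/
def IsCompatibleOrbits (O : ℕ → ℕ → Phase) : Prop :=
  (∀ n, IsOrbit (table n) (O n)) ∧ ∀ m n, m < n → Compatible n (O m 0) (O n 0)

/-- The orbit of `fractalTable` determined by the sequence `O` is recurrent, and `r j` is, for
every `j ≥ 1`, the limit as `n → ∞` of the `j`th return points of the orbits `O n`. -/
def IsRecurrentWith (O : ℕ → ℕ → Phase) (r : ℕ → ℂ) : Prop :=
  IsCompatibleOrbits O ∧ (∀ n, (O n 0).1 = (O 0 0).1) ∧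
  ∃ υ : ℕ → ℕ → ℕ, (∀ n, IsReturnTimes (table n) (O n) (υ n)) ∧
    ∀ j, 1 ≤ j → r j ∈ side (table 0) (O 0 0).1 ∧
      Tendsto (fun n => (O n (υ n j)).1) atTop (𝓝 (r j))

/-- The orbit of `fractalTable` determined by the sequence `O` is a periodic orbit: it is
recurrent, and its sequence of limiting return points is periodic with a finite period. -/
def IsPeriodicFractalOrbit (O : ℕ → ℕ → Phase) : Prop :=
  ∃ r : ℕ → ℂ, IsRecurrentWith O r ∧ ∃ q, 0 < q ∧ ∀ j, 1 ≤ j → r (j + q) = r j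

/-- `N` is the nontrivial path of the sequence `O` of compatible orbits, all of whose first escape
times are finite. -/
def IsNontrivialPath (O : ℕ → ℕ → Phase) (N : Set ℂ) : Prop :=
  IsCompatibleOrbits O ∧
  ∃ τ : ℕ → ℕ, (∀ n, IsFirstEscapeTime n (O n) (τ n)) ∧
    N = closure (⋃ n, initialPath (O n) (τ n))

/-- The sequence `O` of compatible orbits starts with the initial condition `((x, 0), θ)`. -/
def IsCompatibleFrom (x θ : ℝ) (O : ℕ → ℕ → Phase) : Prop :=
  IsCompatibleOrbits O ∧ O 0 0 = (⟨x, 0⟩, ⟨Real.cos θ, Real.sin θ⟩)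

end TFractal

/-! While a ball climbs a rectangle, its abscissa is a linear function of the height, folded at the
vertical sides. As `p` is odd, a ball that leaves `(x, 0)` with inverse slope `σ * p` crosses the
unit square to `(1 - x, 1)` and arrives with the opposite orientation. In the cap, of width 2 and
height 1/2, it either reaches a gate (one of the two top segments that the next table removes) at
once, or first bounces off the middle of the top and off a ledge at height 1 (`course_ascent`). The
gate depends only on `σ * p` modulo 8, and the position in the copy of the table behind it is, up to
the reflection `u ↦ 1 - u`, the image of `x` under the doubling map. The copies are homothetic to
the table and doubling preserves non-dyadic numbers, so the ball never meets a vertex and climbs to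
a gate of level `n` (`course_escape`).

The points `x` and `1 - x` lead to the same entry point with opposite orientations. By
self-similarity the same holds at level `n` for `x` and `mirror n x`, whose first `n` binary digits
agree and whose other digits are all opposite (`escapePoint_mirror`, `escapeSign_mirror`). In `table
n` the gate is a wall. The ball reflected there runs the ascent from `mirror n x` backwards and
returns to the base at `mirror n x`, at distance at most `2⁻ⁿ` from `x`, with its horizontal
orientation reversed. A second round trip leads back to `x` and closes the orbit
(`exists_run_cycle`). Hence the orbit is periodic and its return points tend to `x`.

Its path consists of four ascents, from `x` and from `mirror n x` with both orientations. Ascents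
from the two points visit the same copies and stay within a multiple of `2⁻ⁿ` of each other
(`near_escapePath_mirror`); ascents from `x` to different levels `≥ n` differ only inside a copy of
scale `2⁻ⁿ` (`near_escapePath`). So the paths converge to the union of the two nontrivial paths. -/

namespace TFractal

/-! ### Flat walls -/

/-- Near `x` the set `Ω` is the half-plane on which `z ↦ ℓ (z - x)` is nonnegative. -/
def Wall (ℓ : ℂ →L[ℝ] ℝ) (Ω : Set ℂ) (x : ℂ) : Prop := ∀ᶠ z in 𝓝 x, (z ∈ Ω ↔ 0 ≤ ℓ (z - x))

/-- Interior and frontier commute with preimages under continuous open maps, so at a flat wall both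
can be computed on the half-line `Ici 0`. -/
theorem isOpenMap_apply_sub {ℓ : ℂ →L[ℝ] ℝ} (hℓ : ℓ ≠ 0) (x : ℂ) :
    IsOpenMap fun z => ℓ (z - x) := by
  have hs : Function.Surjective ℓ := ℓ.toLinearMap.surjective (by
    intro h; apply hℓ; ext1; simpa using LinearMap.congr_fun h _)
  exact (ℓ.isOpenMap hs).comp (Homeomorph.subRight x).isOpenMap

theorem eventually_mem_interior_iff {A B : Set ℂ} {x : ℂ} (h : ∀ᶠ z in 𝓝 x, (z ∈ A ↔ z ∈ B)) :
    ∀ᶠ z in 𝓝 x, (z ∈ interior A ↔ z ∈ interior B) := by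
  filter_upwards [h.eventually_nhds] with z hz
  rw [mem_interior_iff_mem_nhds, mem_interior_iff_mem_nhds]
  exact ⟨fun h' => by filter_upwards [h', hz] with y h1 h2 using h2.1 h1,
    fun h' => by filter_upwards [h', hz] with y h1 h2 using h2.2 h1⟩

theorem eventually_mem_frontier_iff {A B : Set ℂ} {x : ℂ} (h : ∀ᶠ z in 𝓝 x, (z ∈ A ↔ z ∈ B)) :
    ∀ᶠ z in 𝓝 x, (z ∈ frontier A ↔ z ∈ frontier B) := by
  have h' : ∀ᶠ z in 𝓝 x, (z ∈ Aᶜ ↔ z ∈ Bᶜ) := by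
    filter_upwards [h] with z hz using not_congr hz
  filter_upwards [eventually_mem_interior_iff h, eventually_mem_interior_iff h'] with z h1 h2
  rw [frontier, frontier, closure_eq_compl_interior_compl, closure_eq_compl_interior_compl]
  simp only [Set.mem_sdiff, mem_compl_iff, h1, h2]

namespace Wall

variable {ℓ : ℂ →L[ℝ] ℝ} {Ω : Set ℂ} {x : ℂ}

theorem congr {Ω' : Set ℂ} (h : Wall ℓ Ω x) (h' : ∀ᶠ z in 𝓝 x, (z ∈ Ω' ↔ z ∈ Ω)) :
    Wall ℓ Ω' x := by
  filter_upwards [h, h'] with z h1 h2 using h2.trans h1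

theorem interior_iff (h : Wall ℓ Ω x) (hℓ : ℓ ≠ 0) :
    ∀ᶠ z in 𝓝 x, (z ∈ interior Ω ↔ 0 < ℓ (z - x)) := by
  have h1 := eventually_mem_interior_iff (B := (fun z => ℓ (z - x)) ⁻¹' Ici 0) h
  rw [← (isOpenMap_apply_sub hℓ x).preimage_interior_eq_interior_preimage (by fun_prop),
    interior_Ici] at h1
  exact h1

theorem frontier_iff (h : Wall ℓ Ω x) (hℓ : ℓ ≠ 0) :
    ∀ᶠ z in 𝓝 x, (z ∈ frontier Ω ↔ ℓ (z - x) = 0) := by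
  have h1 := eventually_mem_frontier_iff (B := (fun z => ℓ (z - x)) ⁻¹' Ici 0) h
  rw [← (isOpenMap_apply_sub hℓ x).preimage_frontier_eq_frontier_preimage (by fun_prop),
    frontier_Ici] at h1
  exact h1

theorem mem_frontier (h : Wall ℓ Ω x) (hℓ : ℓ ≠ 0) : x ∈ frontier Ω :=
  (h.frontier_iff hℓ).self_of_nhds.2 (by simp)

end Wall

theorem tendsto_ray (x v : ℂ) : Tendsto (fun t : ℝ => x + t * v) (𝓝[>] 0) (𝓝 x) := by
  have : Continuous fun t : ℝ => x + t * v := by fun_prop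
  have h := this.tendsto 0
  simp only [Complex.ofReal_zero, zero_mul, add_zero] at h
  exact h.mono_left nhdsWithin_le_nhds

theorem apply_ray (ℓ : ℂ →L[ℝ] ℝ) (x v : ℂ) (t : ℝ) : ℓ (x + t * v - x) = t * ℓ v := by
  rw [add_sub_cancel_left, ← Complex.real_smul, map_smul, smul_eq_mul]

/-- A direction is inward at a flat wall if and only if it points to the correct side. -/
theorem Wall.inward_iff {ℓ : ℂ →L[ℝ] ℝ} {Ω : Set ℂ} {x : ℂ} (h : Wall ℓ Ω x) (hℓ : ℓ ≠ 0) (v : ℂ) :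
    Inward Ω x v ↔ 0 < ℓ v := by
  have h1 := (tendsto_ray x v).eventually (h.interior_iff hℓ)
  simp only [apply_ray] at h1
  constructor
  · rintro ⟨ε, hε, hi⟩
    obtain ⟨t, ht, ht2⟩ := (h1.and (Ioo_mem_nhdsGT hε)).exists
    exact (pos_iff_pos_of_mul_pos (ht.1 (hi t ht2))).1 ht2.1
  · intro hv
    obtain ⟨ε, hε, hε'⟩ := (mem_nhdsGT_iff_exists_Ioo_subset).1 h1
    exact ⟨ε, hε, fun t ht => (hε' ht).2 (mul_pos ht.1 hv)⟩

/-- A ball that moves through the interior reaches a flat wall from the correct side. -/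
theorem Wall.arrival_neg {ℓ : ℂ →L[ℝ] ℝ} {Ω : Set ℂ} {x v y : ℂ} {t : ℝ} (h : Wall ℓ Ω y)
    (hℓ : ℓ ≠ 0) (ht : 0 < t) (hy : y = x + t * v) (hi : ∀ s ∈ Ioo 0 t, x + s * v ∈ interior Ω) :
    ℓ v < 0 := by
  have : Inward Ω y (-v) := by
    refine ⟨t, ht, fun s hs => ?_⟩
    have := hi (t - s) ⟨by linarith [hs.2], by linarith [hs.1]⟩
    convert this using 1
    rw [hy]; push_cast; ring
  have := (h.inward_iff hℓ _).1 this
  rw [map_neg] at this; linarith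

/-- Taken at `e = 1` and `e = I`, this decides whether the point lies on a horizontal or a vertical
side; at a flat wall exactly one of the two occurs. -/
theorem Wall.exists_segment_iff {ℓ : ℂ →L[ℝ] ℝ} {Ω : Set ℂ} {x : ℂ} (h : Wall ℓ Ω x) (hℓ : ℓ ≠ 0)
    (e : ℂ) : (∃ ε : ℝ, ε ≠ 0 ∧ segment ℝ x (x + ε * e) ⊆ frontier Ω) ↔ ℓ e = 0 := by
  have h1 := (tendsto_ray x e).eventually (h.frontier_iff hℓ)
  simp only [apply_ray] at h1
  constructor
  · rintro ⟨ε, hε, hs⟩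
    have h2 := (tendsto_ray x (ε * e)).eventually (h.frontier_iff hℓ)
    simp only [apply_ray] at h2
    obtain ⟨t, ht, ht2⟩ := (h2.and (Ioo_mem_nhdsGT one_pos)).exists
    have h3 := ht.1 (hs (by
      rw [segment_eq_image']
      exact ⟨t, ⟨ht2.1.le, ht2.2.le⟩, by simp⟩))
    rw [← Complex.real_smul, map_smul, smul_eq_mul] at h3
    have := ht2.1.ne'
    simpa [this, hε] using h3
  · intro he
    obtain ⟨ε, hε, hε'⟩ := (mem_nhdsGT_iff_exists_Ioo_subset).1 h1
    have hε0 : (0 : ℝ) < ε := hε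
    refine ⟨ε / 2, by positivity, ?_⟩
    rw [segment_eq_image']
    rintro _ ⟨s, hs, rfl⟩
    rcases hs.1.eq_or_lt with h0 | h0
    · simp only [← h0, zero_smul, add_zero]
      exact h.mem_frontier hℓ
    · have := hε' (a := s * (ε / 2)) ⟨by positivity, by nlinarith [hs.2]⟩
      have := this.2 (by simp [he])
      convert this using 1
      simp only [add_sub_cancel_left, Complex.real_smul]
      push_cast; ring

/-- The billiard map at a flat wall, with `R` the reflection in the wall. -/
theorem billiardStep_of_wall {ℓ : ℂ →L[ℝ] ℝ} {Ω : Set ℂ} {x v y : ℂ} {t : ℝ} {R : ℂ → ℂ}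
    (h : Wall ℓ Ω y) (hℓ : ℓ ≠ 0) (ht : 0 < t) (hy : y = x + t * v)
    (hi : ∀ s ∈ Ioo 0 t, x + s * v ∈ interior Ω) (hR : ∀ u, ℓ (R u) = -ℓ u)
    (hd : ∀ w, DirEquiv Ω y v w ↔ w = v ∨ w = R v) : BilliardStep Ω (x, v) (y, R v) := by
  have hv := h.arrival_neg hℓ ht hy hi
  refine ⟨⟨t, ht, hy, h.mem_frontier hℓ, hi⟩, (hd _).2 (Or.inr rfl), ?_, fun w hw hw' => ?_⟩
  · rw [h.inward_iff hℓ, hR]; linarith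
  · rw [h.inward_iff hℓ] at hw'
    rcases (hd w).1 hw with rfl | rfl
    · linarith
    · rfl

/-- `x` is an interior point of a horizontal side. -/
def HorizontalWall (Ω : Set ℂ) (x : ℂ) : Prop := ∃ s : ℝ, s ≠ 0 ∧ Wall (s • Complex.imCLM) Ω x

/-- `x` is an interior point of a vertical side. -/
def VerticalWall (Ω : Set ℂ) (x : ℂ) : Prop := ∃ s : ℝ, s ≠ 0 ∧ Wall (s • Complex.reCLM) Ω x

theorem smul_imCLM_ne_zero {s : ℝ} (hs : s ≠ 0) : s • Complex.imCLM ≠ 0 := by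
  intro h
  have := congrArg (fun f => f Complex.I) h
  simp [hs] at this

theorem smul_reCLM_ne_zero {s : ℝ} (hs : s ≠ 0) : s • Complex.reCLM ≠ 0 := by
  intro h
  have := congrArg (fun f => f 1) h
  simp [hs] at this

theorem HorizontalWall.mem_frontier {Ω : Set ℂ} {x : ℂ} (h : HorizontalWall Ω x) :
    x ∈ frontier Ω := by
  obtain ⟨s, hs, h⟩ := h
  exact h.mem_frontier (smul_imCLM_ne_zero hs)

theorem onHorizontalSide_iff (Ω : Set ℂ) (x : ℂ) :
    OnHorizontalSide Ω x ↔ ∃ ε : ℝ, ε ≠ 0 ∧ segment ℝ x (x + ε * 1) ⊆ frontier Ω := by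
  refine exists_congr fun ε => ?_
  have : (⟨ε, 0⟩ : ℂ) = ε * 1 := by apply Complex.ext <;> simp
  rw [this]

theorem onVerticalSide_iff (Ω : Set ℂ) (x : ℂ) :
    OnVerticalSide Ω x ↔ ∃ ε : ℝ, ε ≠ 0 ∧ segment ℝ x (x + ε * Complex.I) ⊆ frontier Ω := by
  refine exists_congr fun ε => ?_
  have : (⟨0, ε⟩ : ℂ) = ε * Complex.I := by apply Complex.ext <;> simp
  rw [this]

/-- Away from the vertices only one reflection is available, so the group that identifies directions
has order two. -/
theorem dirEquiv_iff {Ω : Set ℂ} {x : ℂ} {R : ℂ → ℂ} (hR : Function.Involutive R)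
    (h : ∀ v w, ((OnHorizontalSide Ω x ∧ w = ⟨v.re, -v.im⟩) ∨
      (OnVerticalSide Ω x ∧ w = ⟨-v.re, v.im⟩)) ↔ w = R v) (v w : ℂ) :
    DirEquiv Ω x v w ↔ w = v ∨ w = R v := by
  constructor
  · intro hd
    induction hd with
    | rel a b hab => exact Or.inr ((h a b).1 hab)
    | refl a => exact Or.inl rfl
    | symm a b _ ih =>
      rcases ih with rfl | rfl
      · exact Or.inl rfl
      · exact Or.inr (hR a).symm
    | trans a b c _ _ ih1 ih2 =>
      rcases ih1 with rfl | rfl <;> rcases ih2 with rfl | rfl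
      · exact Or.inl rfl
      · exact Or.inr rfl
      · exact Or.inr rfl
      · exact Or.inl (hR a)
  · rintro (rfl | rfl)
    · exact .refl _
    · exact .rel _ _ ((h _ _).2 rfl)

/-- Reflection of a direction in a horizontal line. -/
def reflH (v : ℂ) : ℂ := ⟨v.re, -v.im⟩

/-- Reflection of a direction in a vertical line. -/
def reflV (v : ℂ) : ℂ := ⟨-v.re, v.im⟩

theorem reflH_reflH (v : ℂ) : reflH (reflH v) = v := by simp [reflH]

theorem reflV_reflV (v : ℂ) : reflV (reflV v) = v := by simp [reflV]

theorem billiardStep_horizontal {Ω : Set ℂ} {x v y : ℂ} {t : ℝ} (h : HorizontalWall Ω y)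
    (ht : 0 < t) (hy : y = x + t * v) (hi : ∀ s ∈ Ioo 0 t, x + s * v ∈ interior Ω) :
    BilliardStep Ω (x, v) (y, reflH v) := by
  obtain ⟨s, hs, h⟩ := h
  refine billiardStep_of_wall h (smul_imCLM_ne_zero hs) ht hy hi (fun u => by simp [reflH])
    (dirEquiv_iff reflH_reflH (fun v w => ?_) v)
  rw [onHorizontalSide_iff, onVerticalSide_iff, h.exists_segment_iff (smul_imCLM_ne_zero hs),
    h.exists_segment_iff (smul_imCLM_ne_zero hs)]
  simp [hs, reflH]

theorem billiardStep_vertical {Ω : Set ℂ} {x v y : ℂ} {t : ℝ} (h : VerticalWall Ω y)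
    (ht : 0 < t) (hy : y = x + t * v) (hi : ∀ s ∈ Ioo 0 t, x + s * v ∈ interior Ω) :
    BilliardStep Ω (x, v) (y, reflV v) := by
  obtain ⟨s, hs, h⟩ := h
  refine billiardStep_of_wall h (smul_reCLM_ne_zero hs) ht hy hi (fun u => by simp [reflV])
    (dirEquiv_iff reflV_reflV (fun v w => ?_) v)
  rw [onHorizontalSide_iff, onVerticalSide_iff, h.exists_segment_iff (smul_reCLM_ne_zero hs),
    h.exists_segment_iff (smul_reCLM_ne_zero hs)]
  simp [hs, reflV]

/-- The billiard map is single-valued. -/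
theorem BilliardStep.unique {Ω : Set ℂ} {z z₁ z₂ : Phase} (h₁ : BilliardStep Ω z z₁)
    (h₂ : BilliardStep Ω z z₂) : z₁ = z₂ := by
  obtain ⟨⟨t₁, ht₁, e₁, f₁, i₁⟩, d₁, w₁, u₁⟩ := h₁
  obtain ⟨⟨t₂, ht₂, e₂, f₂, i₂⟩, d₂, w₂, u₂⟩ := h₂
  have key : t₁ = t₂ := by
    rcases lt_trichotomy t₁ t₂ with h | h | h
    · exact absurd f₁ (by rw [e₁]; exact fun hf => hf.2 (i₂ t₁ ⟨ht₁, h⟩))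
    · exact h
    · exact absurd f₂ (by rw [e₂]; exact fun hf => hf.2 (i₁ t₂ ⟨ht₂, h⟩))
  have e : z₁.1 = z₂.1 := by rw [e₁, e₂, key]
  refine Prod.ext e (u₂ _ ?_ ?_)
  · rwa [← e]
  · rwa [← e]

theorem IsOrbit.unique {Ω : Set ℂ} {o o' : ℕ → Phase} (h : IsOrbit Ω o) (h' : IsOrbit Ω o')
    (h0 : o 0 = o' 0) : o = o' := by
  funext k
  induction k with
  | zero => exact h0
  | succ k ih =>
    have := h.2.2.2 k
    rw [ih] at this
    exact this.unique (h'.2.2.2 k)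

/-! ### Courses: concatenations of free flights, passages and reflections -/

/-- A ball that starts at `z` arrives at `w` (with incoming direction `w.2`) along the path `S`: it
flies through `I`, may pass through points of `I`, and is reflected at the points of `H` and `V`. -/
inductive Course (I H V : Set ℂ) : Phase → Phase → Set ℂ → Prop
  | flight {z w : Phase} (t : ℝ) (ht : 0 < t) (h1 : w.1 = z.1 + t * z.2) (h2 : w.2 = z.2)
      (hi : ∀ s ∈ Ioo 0 t, z.1 + s * z.2 ∈ I) : Course I H V z w (segment ℝ z.1 w.1)
  | pass {z y w : Phase} {S S' : Set ℂ} (h : Course I H V z y S) (hy : y.1 ∈ I)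
      (h' : Course I H V y w S') : Course I H V z w (S ∪ S')
  | horizontal {z y w : Phase} {S S' : Set ℂ} (h : Course I H V z y S) (hy : y.1 ∈ H)
      (h' : Course I H V (y.1, reflH y.2) w S') : Course I H V z w (S ∪ S')
  | vertical {z y w : Phase} {S S' : Set ℂ} (h : Course I H V z y S) (hy : y.1 ∈ V)
      (h' : Course I H V (y.1, reflV y.2) w S') : Course I H V z w (S ∪ S')

theorem segment_ray (x v : ℂ) {a b : ℝ} (h : a ≤ b) :
    segment ℝ (x + a * v) (x + b * v) = (fun r : ℝ => x + r * v) '' Icc a b := by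
  have := image_segment ℝ (AffineMap.lineMap (k := ℝ) x (x + v)) a b
  rw [segment_eq_Icc h] at this
  simp only [AffineMap.lineMap_apply, vsub_eq_sub, vadd_eq_add, add_sub_cancel_left,
    Complex.real_smul] at this
  rw [← add_comm x, ← add_comm x] at this
  rw [← this]
  refine image_congr fun r _ => ?_
  simp [AffineMap.lineMap_apply, add_comm]

theorem segment_union_ray (x v : ℂ) {a b c : ℝ} (h : a ≤ b) (h' : b ≤ c) :
    segment ℝ (x + a * v) (x + b * v) ∪ segment ℝ (x + b * v) (x + c * v) =
      segment ℝ (x + a * v) (x + c * v) := by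
  rw [segment_ray x v h, segment_ray x v h', segment_ray x v (h.trans h'), ← image_union,
    Icc_union_Icc_eq_Icc h h']

namespace Course

variable {I H V : Set ℂ} {z w : Phase} {S : Set ℂ}

theorem mono {I' H' V' : Set ℂ} (hI : I ⊆ I') (hH : H ⊆ H') (hV : V ⊆ V')
    (h : Course I H V z w S) : Course I' H' V' z w S := by
  induction h with
  | flight t ht h1 h2 hi => exact .flight t ht h1 h2 fun s hs => hI (hi s hs)
  | pass _ hy _ ih1 ih2 => exact .pass ih1 (hI hy) ih2
  | horizontal _ hy _ ih1 ih2 => exact .horizontal ih1 (hH hy) ih2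
  | vertical _ hy _ ih1 ih2 => exact .vertical ih1 (hV hy) ih2

theorem left_mem (h : Course I H V z w S) : z.1 ∈ S := by
  induction h with
  | flight t ht h1 h2 hi => exact left_mem_segment ..
  | pass _ _ _ ih1 _ => exact Or.inl ih1
  | horizontal _ _ _ ih1 _ => exact Or.inl ih1
  | vertical _ _ _ ih1 _ => exact Or.inl ih1

/-- Time reversal. -/
theorem reverse (h : Course I H V z w S) : Course I H V (w.1, -w.2) (z.1, -z.2) S := by
  induction h with
  | @flight z w t ht h1 h2 hi =>
    rw [segment_symm]
    refine .flight (z := (w.1, -w.2)) (w := (z.1, -z.2)) t ht ?_ ?_ fun s hs => ?_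
    · simp [h1, h2]
    · simp [h2]
    · have := hi (t - s) ⟨by linarith [hs.2], by linarith [hs.1]⟩
      convert this using 1
      simp only [h1, h2]; push_cast; ring
  | pass _ hy _ ih1 ih2 => rw [union_comm]; exact .pass ih2 hy ih1
  | @horizontal z y w S S' _ hy _ ih1 ih2 =>
    rw [union_comm]
    refine .horizontal ih2 hy ?_
    -- Reflecting the reverse of the outgoing direction gives the reverse of the incoming one.
    convert ih1 using 2
    simp [reflH, Complex.ext_iff]
  | @vertical z y w S S' _ hy _ ih1 ih2 =>
    rw [union_comm]
    refine .vertical ih2 hy ?_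
    convert ih1 using 2
    simp [reflV, Complex.ext_iff]

/-- Courses are carried along by homotheties. -/
theorem image {f : ℂ → ℂ} {r : ℝ} (hr : 0 < r) (hf : ∀ x v, f (x + v) = f x + r * v)
    (h : Course I H V z w S) :
    Course (f '' I) (f '' H) (f '' V) (f z.1, z.2) (f w.1, w.2) (f '' S) := by
  induction h with
  | @flight z w t ht h1 h2 hi =>
    have e : f '' segment ℝ z.1 w.1 = segment ℝ (f z.1) (f w.1) := by
      have hw := segment_ray z.1 z.2 ht.le
      have hw' := segment_ray (f z.1) (r * z.2) ht.le
      simp only [Complex.ofReal_zero, zero_mul, add_zero, ← h1] at hw hw'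
      have e2 : f w.1 = f z.1 + t * (r * z.2) := by rw [h1, hf]; ring
      rw [hw, e2, hw', image_image]
      refine image_congr fun s _ => ?_
      rw [hf]; ring
    rw [e]
    -- Directions are not rescaled by `f`, so the flight time is multiplied by `r`.
    refine .flight (z := (f z.1, z.2)) (w := (f w.1, w.2)) (r * t) (by positivity) ?_ h2
      fun s hs => ⟨z.1 + (s / r : ℝ) * z.2, hi _ ⟨by have := hs.1; positivity, ?_⟩, ?_⟩
    · simp only [h1, hf]; push_cast; ring
    · rw [div_lt_iff₀ hr]; linarith [hs.2]
    · have : (r : ℂ) ≠ 0 := by exact_mod_cast hr.ne'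
      simp only [hf]; push_cast; field_simp
  | pass _ hy _ ih1 ih2 => rw [image_union]; exact .pass ih1 (mem_image_of_mem f hy) ih2
  | horizontal _ hy _ ih1 ih2 => rw [image_union]; exact .horizontal ih1 (mem_image_of_mem f hy) ih2
  | vertical _ hy _ ih1 ih2 => rw [image_union]; exact .vertical ih1 (mem_image_of_mem f hy) ih2

end Course

/-! ### Finite pieces of billiard orbits -/

/-- `k` iterations of the billiard map lead from `z` to `w` along the path `S`, with collisions
in `W`. -/
inductive Run (Ω W : Set ℂ) : ℕ → Phase → Phase → Set ℂ → Prop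
  | refl (z : Phase) : Run Ω W 0 z z ∅
  | snoc {k : ℕ} {z y w : Phase} {S : Set ℂ} (h : Run Ω W k z y S) (hs : BilliardStep Ω y w)
      (hw : w.1 ∈ W) : Run Ω W (k + 1) z w (S ∪ segment ℝ y.1 w.1)

namespace Run

variable {Ω W : Set ℂ} {k l : ℕ} {x y z w : Phase} {S T : Set ℂ}

theorem trans (h : Run Ω W k x y S) (h' : Run Ω W l y z T) : Run Ω W (k + l) x z (S ∪ T) := by
  induction h' with
  | refl => simpa using h
  | snoc _ hs hw ih => rw [← union_assoc, ← add_assoc]; exact .snoc (ih h) hs hw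

theorem mono {W' : Set ℂ} (hW : W ⊆ W') (h : Run Ω W k x y S) : Run Ω W' k x y S := by
  induction h with
  | refl => exact .refl _
  | snoc _ hs hw ih => exact .snoc ih hs (hW hw)

theorem reflTransGen (h : Run Ω W k x y S) : Relation.ReflTransGen (BilliardStep Ω) x y := by
  induction h with
  | refl => exact .refl
  | snoc _ hs _ ih => exact .tail ih hs

theorem transGen (h : Run Ω W k x y S) (hk : 0 < k) : Relation.TransGen (BilliardStep Ω) x y := by
  cases h with
  | refl => exact absurd hk (lt_irrefl _)
  | snoc h hs _ => exact .tail' h.reflTransGen hs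

/-- The billiard map is single-valued, so an orbit must follow any run that begins at its starting
phase; its path and collisions can be read off from the run. -/
theorem eq_orbit {o : ℕ → Phase} (ho : ∀ k, BilliardStep Ω (o k) (o (k + 1)))
    (h : Run Ω W k (o 0) y S) :
    o k = y ∧ initialPath o k = S ∧ ∀ j, 0 < j → j ≤ k → (o j).1 ∈ W := by
  generalize hz : o 0 = z at h
  induction h with
  | refl z => exact ⟨hz, by simp [initialPath], fun j h1 h2 => by omega⟩
  | @snoc k z y w S _ hs hw ih =>
    obtain ⟨h1, h2, h3⟩ := ih hz
    have e : o (k + 1) = w := (ho k).unique (h1 ▸ hs)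
    refine ⟨e, ?_, fun j hj hj' => ?_⟩
    · rw [initialPath, Finset.range_add_one, Finset.set_biUnion_insert, h1, e, union_comm,
        ← h2, initialPath]
    · rcases hj'.eq_or_lt with rfl | hlt
      · rwa [e]
      · exact h3 j hj (by omega)

/-- Every phase from which `z` is reached in at least one step has a successor of the same kind: if
that successor is `z` itself, the closed run supplies the steps. So the map can be iterated forever.
-/
theorem exists_orbit (h : Run Ω W k z z S) (hk : 0 < k) (hz : z.1 ∈ frontier Ω) (hz' : ‖z.2‖ = 1)
    (hi : Inward Ω z.1 z.2) : ∃ o, IsOrbit Ω o ∧ o 0 = z := by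
  let G := {x // Relation.TransGen (BilliardStep Ω) x z}
  have key : ∀ x : G, ∃ y : G, BilliardStep Ω x.1 y.1 := by
    rintro ⟨x, hx⟩
    obtain ⟨y, hy, hyz⟩ := Relation.TransGen.head'_iff.1 hx
    rcases Relation.reflTransGen_iff_eq_or_transGen.1 hyz with rfl | hyz
    · exact ⟨⟨z, h.transGen hk⟩, hy⟩
    · exact ⟨⟨y, hyz⟩, hy⟩
  choose f hf using key
  refine ⟨fun k => (f^[k] ⟨z, h.transGen hk⟩).1, ⟨hz, hz', hi, fun k => ?_⟩, rfl⟩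
  simp only [Function.iterate_succ_apply']
  exact hf _

end Run

/-- Every course in a table is accompanied by a piece of a billiard orbit. -/
theorem Course.exists_run {Ω I H V : Set ℂ} (hI : I ⊆ interior Ω)
    (hH : ∀ x ∈ H, HorizontalWall Ω x) (hV : ∀ x ∈ V, VerticalWall Ω x) {z w : Phase} {S : Set ℂ}
    (h : Course I H V z w S) : ∀ {z₀ : Phase} {s : ℝ}, 0 ≤ s → z.1 = z₀.1 + s * z₀.2 →
      z.2 = z₀.2 → (∀ r ∈ Ioc 0 s, z₀.1 + r * z₀.2 ∈ interior Ω) →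
    ∃ (k : ℕ) (y : Phase) (T : Set ℂ) (t : ℝ), Run Ω (H ∪ V) k z₀ y T ∧ 0 < t ∧
      w.1 = y.1 + t * y.2 ∧ w.2 = y.2 ∧ (∀ r ∈ Ioo 0 t, y.1 + r * y.2 ∈ interior Ω) ∧
      T ∪ segment ℝ y.1 w.1 = segment ℝ z₀.1 z.1 ∪ S := by
  -- A billiard step is complete only at the next reflection. The induction therefore carries the
  -- last collision `z₀` and the time `s` flown since then, and hands on the unfinished flight of
  -- duration `t` from `y`. A passage prolongs this flight; a reflection ends it and restarts with
  -- `s = 0`.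
  induction h with
  | @flight z w t ht h1 h2 hi =>
    intro z₀ s hs e1 e2 hi'
    have e3 : w.1 = z₀.1 + (s + t : ℝ) * z₀.2 := by rw [h1, e1, e2]; push_cast; ring
    refine ⟨0, z₀, ∅, s + t, .refl _, by positivity, e3, by rw [h2, e2], fun r hr => ?_, ?_⟩
    · rcases le_or_gt r s with hrs | hrs
      · exact hi' r ⟨hr.1, hrs⟩
      · have := hI (hi (r - s) ⟨by linarith, by linarith [hr.2]⟩)
        convert this using 1
        rw [e1, e2]; push_cast; ring
    · have := segment_union_ray z₀.1 z₀.2 hs (le_add_of_nonneg_right ht.le)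
      rw [← e1, ← e3] at this
      simpa using this.symm
  | @pass z y w S S' _ hy _ ih1 ih2 =>
    intro z₀ s hs e1 e2 hi'
    obtain ⟨k, y₁, T, t, hr, ht, f1, f2, f3, f4⟩ := ih1 hs e1 e2 hi'
    obtain ⟨k', y₂, T', t', hr', ht', g1, g2, g3, g4⟩ := ih2 ht.le f1 f2 (fun r hr => by
      rcases hr.2.eq_or_lt with rfl | h
      · rw [← f1]; exact hI hy
      · exact f3 r ⟨hr.1, h⟩)
    refine ⟨k + k', y₂, T ∪ T', t', hr.trans hr', ht', g1, g2, g3, ?_⟩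
    rw [union_assoc, g4, ← union_assoc, f4, union_assoc]
  | @horizontal z y w S S' _ hy hc ih1 ih2 =>
    intro z₀ s hs e1 e2 hi'
    obtain ⟨k, y₁, T, t, hr, ht, f1, f2, f3, f4⟩ := ih1 hs e1 e2 hi'
    obtain ⟨k', y₂, T', t', hr', ht', g1, g2, g3, g4⟩ := ih2 (z₀ := (y.1, reflH y.2)) le_rfl
      (by simp) rfl (by simp)
    have hb : BilliardStep Ω y₁ (y.1, reflH y.2) := by
      rw [f2]; exact billiardStep_horizontal (hH _ hy) ht f1 f3
    refine ⟨k + 1 + k', y₂, _, t', (hr.snoc hb (Or.inl hy)).trans hr', ht', g1, g2, g3, ?_⟩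
    rw [union_assoc, g4, f4, segment_same, singleton_union, insert_eq_of_mem hc.left_mem,
      union_assoc]
  | @vertical z y w S S' _ hy hc ih1 ih2 =>
    intro z₀ s hs e1 e2 hi'
    obtain ⟨k, y₁, T, t, hr, ht, f1, f2, f3, f4⟩ := ih1 hs e1 e2 hi'
    obtain ⟨k', y₂, T', t', hr', ht', g1, g2, g3, g4⟩ := ih2 (z₀ := (y.1, reflV y.2)) le_rfl
      (by simp) rfl (by simp)
    have hb : BilliardStep Ω y₁ (y.1, reflV y.2) := by
      rw [f2]; exact billiardStep_vertical (hV _ hy) ht f1 f3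
    refine ⟨k + 1 + k', y₂, _, t', (hr.snoc hb (Or.inr hy)).trans hr', ht', g1, g2, g3, ?_⟩
    rw [union_assoc, g4, f4, segment_same, singleton_union, insert_eq_of_mem hc.left_mem,
      union_assoc]

/-- A course that ends at a horizontal wall is followed by a billiard orbit; only its last
collision may be outside `H ∪ V`. -/
theorem Course.run_of_horizontalWall {Ω I H V : Set ℂ} (hI : I ⊆ interior Ω)
    (hH : ∀ x ∈ H, HorizontalWall Ω x) (hV : ∀ x ∈ V, VerticalWall Ω x) {z w : Phase} {S : Set ℂ}
    (h : Course I H V z w S) (hw : HorizontalWall Ω w.1) :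
    ∃ (k : ℕ) (y : Phase) (T : Set ℂ), Run Ω (H ∪ V) k z y T ∧
      BilliardStep Ω y (w.1, reflH w.2) ∧ T ∪ segment ℝ y.1 w.1 = S := by
  obtain ⟨k, y, T, t, hr, ht, f1, f2, f3, f4⟩ := h.exists_run hI hH hV (z₀ := z) le_rfl (by simp)
    rfl (by simp)
  refine ⟨k, y, T, hr, ?_, ?_⟩
  · rw [f2]; exact billiardStep_horizontal hw ht f1 f3
  · rw [f4, segment_same, singleton_union, insert_eq_of_mem h.left_mem]

theorem IsOrbit.periodic {Ω : Set ℂ} {o : ℕ → Phase} (h : IsOrbit Ω o) {m : ℕ} (hm : o m = o 0) :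
    Function.Periodic o m := by
  intro k
  induction k with
  | zero => rw [zero_add, hm]
  | succ k ih =>
    rw [show k + 1 + m = k + m + 1 by omega]
    have := h.2.2.2 (k + m)
    rw [ih] at this
    exact this.unique (h.2.2.2 k)

theorem orbitPath_of_periodic {o : ℕ → Phase} {m : ℕ} (hm : 0 < m) (h : Function.Periodic o m) :
    orbitPath o = initialPath o m := by
  apply Subset.antisymm
  · refine iUnion_subset fun k => ?_
    have e : ∀ j, o (k % m + j) = o (k + j) := by
      intro j
      conv_rhs => rw [← Nat.mod_add_div k m, add_right_comm, mul_comm]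
      exact (h.nat_mul (k / m) (k % m + j)).symm
    have := e 0
    simp only [add_zero] at this
    rw [← this, ← e 1]
    exact subset_biUnion_of_mem (u := fun k => segment ℝ (o k).1 (o (k + 1)).1)
      (Finset.mem_coe.2 (Finset.mem_range.2 (Nat.mod_lt k hm)))
  · exact iUnion₂_subset fun k _ => subset_iUnion (fun k => segment ℝ (o k).1 (o (k + 1)).1) k

/-! ### The local structure of the tables -/

/-- The abscissa of the lower left corner of the copy `b` of the table in the next table. -/
noncomputable def shift (b : Bool) : ℝ := if b then 1 else -1 / 2

/-- The contraction with index `b`. -/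
noncomputable def branch (b : Bool) (z : ℂ) : ℂ := z / 2 + ⟨shift b, 3 / 2⟩

/-- The inverse of `branch b`. -/
noncomputable def unbranch (b : Bool) (z : ℂ) : ℂ := 2 * (z - ⟨shift b, 3 / 2⟩)

@[simp] theorem branch_re (b : Bool) (z : ℂ) : (branch b z).re = z.re / 2 + shift b := by
  simp [branch]

@[simp] theorem branch_im (b : Bool) (z : ℂ) : (branch b z).im = z.im / 2 + 3 / 2 := by
  simp [branch]

@[simp] theorem unbranch_re (b : Bool) (z : ℂ) : (unbranch b z).re = 2 * (z.re - shift b) := by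
  simp [unbranch]

@[simp] theorem unbranch_im (b : Bool) (z : ℂ) : (unbranch b z).im = 2 * (z.im - 3 / 2) := by
  simp [unbranch]

@[simp] theorem unbranch_branch (b : Bool) (z : ℂ) : unbranch b (branch b z) = z := by
  simp only [branch, unbranch]; ring

@[simp] theorem branch_unbranch (b : Bool) (z : ℂ) : branch b (unbranch b z) = z := by
  simp only [branch, unbranch]; ring

theorem mem_branch_image {b : Bool} {S : Set ℂ} {z : ℂ} :
    z ∈ branch b '' S ↔ unbranch b z ∈ S :=
  ⟨by rintro ⟨y, hy, rfl⟩; simpa using hy, fun h => ⟨_, h, by simp⟩⟩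

theorem continuous_unbranch (b : Bool) : Continuous (unbranch b) := by
  unfold unbranch; fun_prop

theorem Phi_eq (S : Set ℂ) : Phi S = ⋃ b, branch b '' S := by
  rw [show ⋃ b, branch b '' S = branch true '' S ∪ branch false '' S by ext; simp [or_comm]]
  have h1 : branch true = phi₁ := by funext z; simp [branch, phi₁, shift]
  have h2 : branch false = phi₂ := by funext z; simp [branch, phi₂, shift]
  rw [h1, h2, Phi]

theorem table_zero : table 0 = table₀ := by simp [table]

/-- The recursion peels off the outermost contraction, which is what lets the inductions on the
level use self-similarity. -/
theorem table_succ (n : ℕ) : table (n + 1) = table₀ ∪ ⋃ b, branch b '' table n := by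
  ext z
  simp only [table, mem_union, mem_iUnion, Finset.mem_range, exists_prop, mem_branch_image]
  constructor
  · rintro ⟨_ | j, hj, hz⟩
    · exact Or.inl hz
    · rw [Function.iterate_succ_apply', Phi_eq] at hz
      simp only [mem_iUnion, mem_branch_image] at hz
      obtain ⟨b, hz⟩ := hz
      exact Or.inr ⟨b, j, by omega, hz⟩
  · rintro (hz | ⟨b, j, hj, hz⟩)
    · exact ⟨0, by omega, hz⟩
    · refine ⟨j + 1, by omega, ?_⟩
      rw [Function.iterate_succ_apply', Phi_eq]
      simp only [mem_iUnion, mem_branch_image]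
      exact ⟨b, hz⟩

theorem removed_succ (n : ℕ) : removed (n + 1) = ⋃ b, branch b '' removed n := by
  rw [removed, Function.iterate_succ_apply', Phi_eq, removed]

theorem removed_zero : removed 0 = ⋃ b, branch b '' base := by
  rw [removed, zero_add, Function.iterate_one, Phi_eq]

theorem mem_table₀ {z : ℂ} : z ∈ table₀ ↔
    ((0 ≤ z.re ∧ z.re ≤ 1) ∧ 0 ≤ z.im ∧ z.im ≤ 1) ∨
      ((-1 / 2 ≤ z.re ∧ z.re ≤ 3 / 2) ∧ 1 ≤ z.im ∧ z.im ≤ 3 / 2) := by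
  simp [table₀, Complex.mem_reProdIm]

theorem mem_base {z : ℂ} : z ∈ base ↔ (0 ≤ z.re ∧ z.re ≤ 1) ∧ z.im = 0 := by
  simp [base, Complex.mem_reProdIm]

theorem shift_cases (b : Bool) : (b = true ∧ shift b = 1) ∨ (b = false ∧ shift b = -1 / 2) := by
  cases b <;> simp [shift]

/-- An open set that contains all the tables except for the base. -/
def zone : Set ℂ := {z | 0 < z.im ∧ -1 < z.re ∧ z.re < 2}

/-- The strict bounds on the abscissa keep the two copies on different sides of the line `re = 1/2`;
the last clause says that the bottom of a copy stays above its gate. -/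
theorem table_bounds {n : ℕ} {z : ℂ} (h : z ∈ table n) :
    0 ≤ z.im ∧ z.im ≤ 3 ∧ -1 < z.re ∧ z.re < 2 ∧ (z.im < 1 → 0 ≤ z.re ∧ z.re ≤ 1) := by
  induction n generalizing z with
  | zero =>
    rw [table_zero, mem_table₀] at h
    rcases h with h | h <;> refine ⟨?_, ?_, ?_, ?_, fun _ => ⟨?_, ?_⟩⟩ <;> linarith
  | succ n ih =>
    rw [table_succ] at h
    rcases h with h | h
    · rw [mem_table₀] at h
      rcases h with h | h <;> refine ⟨?_, ?_, ?_, ?_, fun _ => ⟨?_, ?_⟩⟩ <;> linarith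
    · simp only [mem_iUnion, mem_branch_image] at h
      obtain ⟨b, h⟩ := h
      obtain ⟨h1, h2, h3, h4, -⟩ := ih h
      simp only [unbranch_re, unbranch_im] at h1 h2 h3 h4
      rcases shift_cases b with ⟨-, e⟩ | ⟨-, e⟩ <;> rw [e] at h3 h4 <;>
        refine ⟨?_, ?_, ?_, ?_, fun _ => ⟨?_, ?_⟩⟩ <;> linarith

theorem table₀_subset_table (n : ℕ) : table₀ ⊆ table n := by
  cases n with
  | zero => rw [table_zero]
  | succ n => rw [table_succ]; exact subset_union_left

theorem branch_table_subset (n : ℕ) (b : Bool) : branch b '' table n ⊆ table (n + 1) := by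
  rw [table_succ]
  exact (subset_iUnion (fun b => branch b '' table n) b).trans subset_union_right

/-- The copies start at height 3/2, and up to height 2 they lie above the gates. So the local shape
of the initial table at its lower sides and at the middle of its top is never changed. -/
theorem mem_table_iff_of_low (n : ℕ) {z : ℂ} (h : z.im < 3 / 2 ∨ (0 < z.re ∧ z.re < 1 ∧ z.im < 2)) :
    z ∈ table n ↔ z ∈ table₀ := by
  cases n with
  | zero => rw [table_zero]
  | succ n =>
    refine ⟨fun hz => ?_, fun hz => table₀_subset_table _ hz⟩
    rw [table_succ] at hz
    rcases hz with hz | hz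
    · exact hz
    · simp only [mem_iUnion, mem_branch_image] at hz
      obtain ⟨b, hz⟩ := hz
      obtain ⟨h1, -, -, -, h5⟩ := table_bounds hz
      simp only [unbranch_re, unbranch_im] at h1 h5
      rcases h with h | ⟨h, h', h''⟩
      · linarith
      · have := h5 (by linarith)
        rcases shift_cases b with ⟨-, e⟩ | ⟨-, e⟩ <;> rw [e] at this <;> linarith

theorem isOpen_low : IsOpen {z : ℂ | z.im < 3 / 2 ∨ (0 < z.re ∧ z.re < 1 ∧ z.im < 2)} := by
  have h1 : IsOpen {z : ℂ | z.im < 3 / 2} := isOpen_lt (by fun_prop) (by fun_prop)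
  have h2 : IsOpen {z : ℂ | 0 < z.re} := isOpen_lt (by fun_prop) (by fun_prop)
  have h3 : IsOpen {z : ℂ | z.re < 1} := isOpen_lt (by fun_prop) (by fun_prop)
  have h4 : IsOpen {z : ℂ | z.im < 2} := isOpen_lt (by fun_prop) (by fun_prop)
  exact h1.union (h2.inter (h3.inter h4))

theorem eventually_mem_table_iff_of_low (n : ℕ) {x : ℂ}
    (h : x.im < 3 / 2 ∨ (0 < x.re ∧ x.re < 1 ∧ x.im < 2)) :
    ∀ᶠ z in 𝓝 x, (z ∈ table n ↔ z ∈ table₀) := by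
  filter_upwards [isOpen_low.mem_nhds h] with z hz using mem_table_iff_of_low n hz

theorem isOpen_zone : IsOpen zone := by
  have h1 : IsOpen {z : ℂ | 0 < z.im} := isOpen_lt (by fun_prop) (by fun_prop)
  have h2 : IsOpen {z : ℂ | -1 < z.re} := isOpen_lt (by fun_prop) (by fun_prop)
  have h3 : IsOpen {z : ℂ | z.re < 2} := isOpen_lt (by fun_prop) (by fun_prop)
  exact h1.inter (h2.inter h3)

theorem eq_of_unbranch_mem_zone {b b' : Bool} {z : ℂ} (h : unbranch b z ∈ zone)
    (h' : -1 < (unbranch b' z).re ∧ (unbranch b' z).re < 2) : b' = b := by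
  obtain ⟨-, h2, h3⟩ := h
  simp only [unbranch_re] at h2 h3 h'
  rcases shift_cases b with ⟨e1, e⟩ | ⟨e1, e⟩ <;> rcases shift_cases b' with ⟨e1', e'⟩ | ⟨e1', e'⟩ <;>
    rw [e] at h2 h3 <;> rw [e'] at h' <;> rw [e1, e1'] <;> exfalso <;> linarith

/-- Above height 3/2 the initial table is absent and the other copy is separated by the line `re =
1/2`. Local properties thus pass from `table n` to its copies in `table (n + 1)`, except along the
bottom of a copy. -/
theorem eventually_mem_table_iff_of_zone (n : ℕ) (b : Bool) {x : ℂ} (h : x ∈ zone) :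
    ∀ᶠ z in 𝓝 (branch b x), (z ∈ table (n + 1) ↔ z ∈ branch b '' table n) := by
  have ho := (isOpen_zone.preimage (continuous_unbranch b)).mem_nhds
    (show branch b x ∈ unbranch b ⁻¹' zone by simpa using h)
  filter_upwards [ho] with z hz
  refine ⟨fun hz' => ?_, fun hz' => branch_table_subset n b hz'⟩
  rw [table_succ] at hz'
  rcases hz' with hz' | hz'
  · rw [mem_table₀] at hz'
    have := hz.1
    simp only [unbranch_im] at this
    rcases hz' with hz' | hz' <;> linarith
  · simp only [mem_iUnion, mem_branch_image] at hz'
    obtain ⟨b', hz'⟩ := hz'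
    have hb := table_bounds hz'
    rw [eq_of_unbranch_mem_zone hz ⟨hb.2.2.1, hb.2.2.2.1⟩] at hz'
    exact mem_branch_image.2 hz'

theorem tendsto_unbranch (b : Bool) (x : ℂ) : Tendsto (unbranch b) (𝓝 (branch b x)) (𝓝 x) := by
  simpa using (continuous_unbranch b).tendsto (branch b x)

theorem Wall.branch {ℓ : ℂ →L[ℝ] ℝ} {Ω : Set ℂ} {x : ℂ} (h : Wall ℓ Ω x) (b : Bool) :
    Wall ℓ (branch b '' Ω) (branch b x) := by
  filter_upwards [(tendsto_unbranch b x).eventually h] with z hz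
  rw [mem_branch_image, hz]
  have : unbranch b z - x = (2 : ℝ) • (z - TFractal.branch b x) := by
    simp only [unbranch, TFractal.branch, Complex.real_smul]; push_cast; ring
  rw [this, map_smul, smul_eq_mul]
  exact ⟨fun h => by linarith, fun h => by linarith⟩

/-- The points of `A` and of all its copies up to level `n`. -/
noncomputable def spread (A : Set ℂ) : ℕ → Set ℂ
  | 0 => A
  | n + 1 => A ∪ ⋃ b, branch b '' spread A n

theorem branch_spread_subset (A : Set ℂ) (n : ℕ) (b : Bool) :
    branch b '' spread A n ⊆ spread A (n + 1) :=
  (subset_iUnion (fun b => branch b '' spread A n) b).trans subset_union_right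

theorem subset_spread (A : Set ℂ) (n : ℕ) : A ⊆ spread A n := by
  cases n with
  | zero => exact subset_rfl
  | succ n => exact subset_union_left

/-- A set of interior points of the initial table, without its corners. -/
def inside₀ : Set ℂ := (Ioo (0 : ℝ) 1 ×ℂ Ioc (0 : ℝ) 1) ∪ (Ioo (-1 / 2 : ℝ) (3 / 2) ×ℂ Ioo (1 : ℝ) (3 / 2))

/-- The relative interiors of the two segments that are removed from the initial table. -/
def gates₀ : Set ℂ := (Ioo (-1 / 2 : ℝ) 0 ∪ Ioo (1 : ℝ) (3 / 2)) ×ℂ {(3 / 2 : ℝ)}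

/-- The relative interiors of the other horizontal sides of the initial table above the base. -/
def horizontals₀ : Set ℂ :=
  (Ioo (0 : ℝ) 1 ×ℂ {(3 / 2 : ℝ)}) ∪ ((Ioo (-1 / 2 : ℝ) 0 ∪ Ioo (1 : ℝ) (3 / 2)) ×ℂ {(1 : ℝ)})

/-- The relative interiors of the vertical sides of the initial table. -/
def verticals₀ : Set ℂ :=
  (({0, 1} : Set ℝ) ×ℂ Ioo (0 : ℝ) 1) ∪ (({-1 / 2, 3 / 2} : Set ℝ) ×ℂ Ioo (1 : ℝ) (3 / 2))

/-- A set of interior points of the `n`th table. -/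
noncomputable def inside : ℕ → Set ℂ
  | 0 => inside₀
  | n + 1 => (inside₀ ∪ gates₀) ∪ ⋃ b, branch b '' inside n

/-- The relative interiors of the segments that are removed from the `n`th table. -/
noncomputable def gates : ℕ → Set ℂ
  | 0 => gates₀
  | n + 1 => ⋃ b, branch b '' gates n

/-- Horizontal walls of the `n`th table. -/
noncomputable def horizontals (n : ℕ) : Set ℂ := spread horizontals₀ n

/-- Vertical walls of the `n`th table. -/
noncomputable def verticals (n : ℕ) : Set ℂ := spread verticals₀ n

theorem branch_mem_zone {b : Bool} {z : ℂ} (h : z ∈ zone) : branch b z ∈ zone := by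
  obtain ⟨h1, h2, h3⟩ := h
  refine ⟨?_, ?_, ?_⟩ <;> simp only [branch_re, branch_im] <;>
    rcases shift_cases b with ⟨-, e⟩ | ⟨-, e⟩ <;> linarith

theorem iUnion_branch_subset_zone {A : Set ℂ} (h : A ⊆ zone) : ⋃ b, branch b '' A ⊆ zone :=
  iUnion_subset fun _ => image_subset_iff.2 fun _ hz => branch_mem_zone (h hz)

theorem spread_subset_zone {A : Set ℂ} (h : A ⊆ zone) (n : ℕ) : spread A n ⊆ zone := by
  induction n with
  | zero => exact h
  | succ n ih => exact union_subset h (iUnion_branch_subset_zone ih)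

theorem mem_inside₀ {z : ℂ} : z ∈ inside₀ ↔ ((0 < z.re ∧ z.re < 1) ∧ 0 < z.im ∧ z.im ≤ 1) ∨
    ((-1 / 2 < z.re ∧ z.re < 3 / 2) ∧ 1 < z.im ∧ z.im < 3 / 2) := by
  simp [inside₀, Complex.mem_reProdIm]

theorem mem_gates₀ {z : ℂ} : z ∈ gates₀ ↔
    ((-1 / 2 < z.re ∧ z.re < 0) ∨ (1 < z.re ∧ z.re < 3 / 2)) ∧ z.im = 3 / 2 := by
  simp [gates₀, Complex.mem_reProdIm]

theorem mem_horizontals₀ {z : ℂ} : z ∈ horizontals₀ ↔ ((0 < z.re ∧ z.re < 1) ∧ z.im = 3 / 2) ∨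
    ((-1 / 2 < z.re ∧ z.re < 0) ∨ (1 < z.re ∧ z.re < 3 / 2)) ∧ z.im = 1 := by
  simp [horizontals₀, Complex.mem_reProdIm]

theorem mem_verticals₀ {z : ℂ} : z ∈ verticals₀ ↔ ((z.re = 0 ∨ z.re = 1) ∧ 0 < z.im ∧ z.im < 1) ∨
    ((z.re = -1 / 2 ∨ z.re = 3 / 2) ∧ 1 < z.im ∧ z.im < 3 / 2) := by
  simp [verticals₀, Complex.mem_reProdIm]

theorem gates₀_subset_zone : gates₀ ⊆ zone := by
  intro z hz
  rw [mem_gates₀] at hz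
  obtain ⟨h | h, h'⟩ := hz <;> refine ⟨?_, ?_, ?_⟩ <;> linarith

theorem horizontals₀_subset_zone : horizontals₀ ⊆ zone := by
  intro z hz
  rw [mem_horizontals₀] at hz
  obtain ⟨h, h'⟩ | ⟨h | h, h'⟩ := hz <;> refine ⟨?_, ?_, ?_⟩ <;> linarith

theorem verticals₀_subset_zone : verticals₀ ⊆ zone := by
  intro z hz
  rw [mem_verticals₀] at hz
  obtain ⟨h | h, h'⟩ | ⟨h | h, h'⟩ := hz <;> refine ⟨?_, ?_, ?_⟩ <;> linarith

theorem gates_subset_zone (n : ℕ) : gates n ⊆ zone := by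
  induction n with
  | zero => exact gates₀_subset_zone
  | succ n ih => exact iUnion_branch_subset_zone ih

theorem inside₀_subset_inside (n : ℕ) : inside₀ ⊆ inside n := by
  cases n with
  | zero => exact subset_rfl
  | succ n => exact subset_union_left.trans subset_union_left

theorem branch_inside_subset (n : ℕ) (b : Bool) : branch b '' inside n ⊆ inside (n + 1) :=
  (subset_iUnion (fun b => branch b '' inside n) b).trans subset_union_right

theorem gates₀_subset_inside (n : ℕ) : gates₀ ⊆ inside (n + 1) :=
  subset_union_right.trans subset_union_left

/-! ### Interior points and flat walls of the tables -/

theorem eventually_re_lt {x : ℂ} {c : ℝ} (h : x.re < c) : ∀ᶠ z in 𝓝 x, z.re < c :=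
  (isOpen_lt (by fun_prop) (by fun_prop)).mem_nhds h

theorem eventually_lt_re {x : ℂ} {c : ℝ} (h : c < x.re) : ∀ᶠ z in 𝓝 x, c < z.re :=
  (isOpen_lt (by fun_prop) (by fun_prop)).mem_nhds h

theorem eventually_im_lt {x : ℂ} {c : ℝ} (h : x.im < c) : ∀ᶠ z in 𝓝 x, z.im < c :=
  (isOpen_lt (by fun_prop) (by fun_prop)).mem_nhds h

theorem eventually_lt_im {x : ℂ} {c : ℝ} (h : c < x.im) : ∀ᶠ z in 𝓝 x, c < z.im :=
  (isOpen_lt (by fun_prop) (by fun_prop)).mem_nhds h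

theorem inside₀_subset_interior : inside₀ ⊆ interior table₀ := by
  intro x hx
  rw [mem_interior_iff_mem_nhds]
  rw [mem_inside₀] at hx
  obtain ⟨⟨h1, h2⟩, h3, h4⟩ | ⟨⟨h1, h2⟩, h3, h4⟩ := hx
  · filter_upwards [eventually_lt_re h1, eventually_re_lt h2, eventually_lt_im h3,
      eventually_im_lt (show x.im < 3 / 2 by linarith)] with z g1 g2 g3 g4
    rw [mem_table₀]
    rcases le_or_gt z.im 1 with h | h
    · exact Or.inl ⟨⟨g1.le, g2.le⟩, g3.le, h⟩
    · exact Or.inr ⟨⟨by linarith, by linarith⟩, h.le, g4.le⟩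
  · filter_upwards [eventually_lt_re h1, eventually_re_lt h2, eventually_lt_im h3,
      eventually_im_lt h4] with z g1 g2 g3 g4
    exact mem_table₀.2 (Or.inr ⟨⟨g1.le, g2.le⟩, g3.le, g4.le⟩)

/-- Below the gate lies the cap of the initial table, above it the square of the copy attached
there. -/
theorem gates₀_subset_interior (n : ℕ) : gates₀ ⊆ interior (table (n + 1)) := by
  intro x hx
  rw [mem_interior_iff_mem_nhds]
  rw [mem_gates₀] at hx
  obtain ⟨b, h1, h2⟩ : ∃ b, shift b < x.re ∧ x.re < shift b + 1 / 2 := by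
    rcases hx.1 with h | h
    · exact ⟨false, by simp only [shift]; norm_num; linarith, by simp only [shift]; norm_num; linarith⟩
    · exact ⟨true, by simp only [shift]; norm_num; linarith, by simp only [shift]; norm_num; linarith⟩
  filter_upwards [eventually_lt_re h1, eventually_re_lt h2, eventually_lt_im
    (show 1 < x.im by linarith), eventually_im_lt (show x.im < 2 by linarith)] with z g1 g2 g3 g4
  rcases le_or_gt z.im (3 / 2) with h | h
  · refine table₀_subset_table _ (mem_table₀.2 (Or.inr ⟨?_, g3.le, h⟩))
    rcases shift_cases b with ⟨-, e⟩ | ⟨-, e⟩ <;> rw [e] at g1 g2 <;> constructor <;> linarith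
  · refine branch_table_subset n b (mem_branch_image.2 (table₀_subset_table _ (mem_table₀.2
      (Or.inl ⟨⟨?_, ?_⟩, ?_, ?_⟩)))) <;> simp only [unbranch_re, unbranch_im] <;> linarith

theorem inside_subset_interior (n : ℕ) : inside n ⊆ interior (table n) := by
  induction n with
  | zero => rw [table_zero]; exact inside₀_subset_interior
  | succ n ih =>
    refine union_subset (union_subset (inside₀_subset_interior.trans
      (interior_mono (table₀_subset_table _))) (gates₀_subset_interior n)) ?_
    refine iUnion_subset fun b => image_subset_iff.2 fun x hx => ?_
    have h1 := ih hx
    rw [mem_interior_iff_mem_nhds] at h1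
    rw [mem_preimage, mem_interior_iff_mem_nhds]
    filter_upwards [(tendsto_unbranch b x).eventually h1] with z hz
    exact branch_table_subset n b (mem_branch_image.2 hz)

theorem horizontals₀_wall {x : ℂ} (h : x ∈ horizontals₀) : HorizontalWall table₀ x := by
  rw [mem_horizontals₀] at h
  rcases h with ⟨⟨h1, h2⟩, h3⟩ | ⟨h1, h3⟩
  · refine ⟨-1, by norm_num, ?_⟩
    filter_upwards [eventually_lt_re h1, eventually_re_lt h2, eventually_lt_im
      (show 1 < x.im by linarith)] with z g1 g2 g3
    simp only [mem_table₀, smul_apply, Complex.imCLM_apply, Complex.sub_im,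
      smul_eq_mul, h3]
    exact ⟨by rintro (h | h) <;> linarith, fun h => Or.inr ⟨⟨by linarith, by linarith⟩, g3.le,
      by linarith⟩⟩
  · refine ⟨1, by norm_num, ?_⟩
    rcases h1 with ⟨h1, h2⟩ | ⟨h1, h2⟩ <;>
    filter_upwards [eventually_lt_re h1, eventually_re_lt h2, eventually_im_lt
      (show x.im < 3 / 2 by linarith)] with z g1 g2 g3 <;>
    simp only [mem_table₀, smul_apply, Complex.imCLM_apply, Complex.sub_im,
      smul_eq_mul, h3] <;>
    exact ⟨by rintro (h | h) <;> linarith, fun h => Or.inr ⟨⟨by linarith, by linarith⟩, by linarith,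
      by linarith⟩⟩

theorem gates₀_wall {x : ℂ} (h : x ∈ gates₀) : HorizontalWall table₀ x := by
  rw [mem_gates₀] at h
  obtain ⟨h1, h3⟩ := h
  refine ⟨-1, by norm_num, ?_⟩
  rcases h1 with ⟨h1, h2⟩ | ⟨h1, h2⟩ <;>
  filter_upwards [eventually_lt_re h1, eventually_re_lt h2, eventually_lt_im
    (show 1 < x.im by linarith)] with z g1 g2 g3 <;>
  simp only [mem_table₀, smul_apply, Complex.imCLM_apply, Complex.sub_im,
    smul_eq_mul, h3] <;>
  exact ⟨by rintro (h | h) <;> linarith, fun h => Or.inr ⟨⟨by linarith, by linarith⟩, by linarith,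
    by linarith⟩⟩

theorem verticals₀_wall {x : ℂ} (h : x ∈ verticals₀) : VerticalWall table₀ x := by
  rw [mem_verticals₀] at h
  obtain ⟨h1 | h1, h3, h4⟩ | ⟨h1 | h1, h3, h4⟩ := h
  · refine ⟨1, by norm_num, ?_⟩
    filter_upwards [eventually_re_lt (show x.re < 1 by linarith), eventually_lt_im h3,
      eventually_im_lt h4] with z g1 g2 g3
    simp only [mem_table₀, smul_apply, Complex.reCLM_apply, Complex.sub_re,
      smul_eq_mul, h1]
    exact ⟨by rintro (h | h) <;> linarith, fun h => Or.inl ⟨⟨by linarith, by linarith⟩, by linarith,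
      by linarith⟩⟩
  · refine ⟨-1, by norm_num, ?_⟩
    filter_upwards [eventually_lt_re (show 0 < x.re by linarith), eventually_lt_im h3,
      eventually_im_lt h4] with z g1 g2 g3
    simp only [mem_table₀, smul_apply, Complex.reCLM_apply, Complex.sub_re,
      smul_eq_mul, h1]
    exact ⟨by rintro (h | h) <;> linarith, fun h => Or.inl ⟨⟨by linarith, by linarith⟩, by linarith,
      by linarith⟩⟩
  · refine ⟨1, by norm_num, ?_⟩
    filter_upwards [eventually_re_lt (show x.re < 1 by linarith), eventually_lt_im h3,
      eventually_im_lt h4] with z g1 g2 g3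
    simp only [mem_table₀, smul_apply, Complex.reCLM_apply, Complex.sub_re,
      smul_eq_mul, h1]
    exact ⟨by rintro (h | h) <;> linarith, fun h => Or.inr ⟨⟨by linarith, by linarith⟩, by linarith,
      by linarith⟩⟩
  · refine ⟨-1, by norm_num, ?_⟩
    filter_upwards [eventually_lt_re (show 0 < x.re by linarith), eventually_lt_im h3,
      eventually_im_lt h4] with z g1 g2 g3
    simp only [mem_table₀, smul_apply, Complex.reCLM_apply, Complex.sub_re,
      smul_eq_mul, h1]
    exact ⟨by rintro (h | h) <;> linarith, fun h => Or.inr ⟨⟨by linarith, by linarith⟩, by linarith,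
      by linarith⟩⟩

theorem HorizontalWall.congr {Ω Ω' : Set ℂ} {x : ℂ} (h : HorizontalWall Ω x)
    (h' : ∀ᶠ z in 𝓝 x, (z ∈ Ω' ↔ z ∈ Ω)) : HorizontalWall Ω' x := by
  obtain ⟨s, hs, h⟩ := h
  exact ⟨s, hs, h.congr h'⟩

theorem VerticalWall.congr {Ω Ω' : Set ℂ} {x : ℂ} (h : VerticalWall Ω x)
    (h' : ∀ᶠ z in 𝓝 x, (z ∈ Ω' ↔ z ∈ Ω)) : VerticalWall Ω' x := by
  obtain ⟨s, hs, h⟩ := h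
  exact ⟨s, hs, h.congr h'⟩

theorem HorizontalWall.branch {n : ℕ} {x : ℂ} (h : HorizontalWall (table n) x) (hx : x ∈ zone)
    (b : Bool) : HorizontalWall (table (n + 1)) (branch b x) := by
  obtain ⟨s, hs, h⟩ := h
  exact ⟨s, hs, (h.branch b).congr (eventually_mem_table_iff_of_zone n b hx)⟩

theorem VerticalWall.branch {n : ℕ} {x : ℂ} (h : VerticalWall (table n) x) (hx : x ∈ zone)
    (b : Bool) : VerticalWall (table (n + 1)) (branch b x) := by
  obtain ⟨s, hs, h⟩ := h
  exact ⟨s, hs, (h.branch b).congr (eventually_mem_table_iff_of_zone n b hx)⟩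

/-- Walls of the initial table lie where the later tables add nothing; walls of a copy lie above its
bottom and are inherited from the previous level. -/
theorem horizontals_wall {n : ℕ} {x : ℂ} (h : x ∈ horizontals n) : HorizontalWall (table n) x := by
  have key : ∀ n, ∀ x ∈ horizontals₀, HorizontalWall (table n) x := by
    intro n x hx
    refine (horizontals₀_wall hx).congr (eventually_mem_table_iff_of_low n ?_)
    rw [mem_horizontals₀] at hx
    rcases hx with ⟨⟨h1, h2⟩, h3⟩ | ⟨-, h3⟩
    · exact Or.inr ⟨h1, h2, by linarith⟩
    · exact Or.inl (by linarith)
  induction n generalizing x with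
  | zero => exact key 0 x h
  | succ n ih =>
    rcases h with h | h
    · exact key _ x h
    · obtain ⟨b, y, hy, rfl⟩ := mem_iUnion.1 h
      exact (ih hy).branch (spread_subset_zone horizontals₀_subset_zone n hy) b

theorem verticals_wall {n : ℕ} {x : ℂ} (h : x ∈ verticals n) : VerticalWall (table n) x := by
  have key : ∀ n, ∀ x ∈ verticals₀, VerticalWall (table n) x := by
    intro n x hx
    refine (verticals₀_wall hx).congr (eventually_mem_table_iff_of_low n (Or.inl ?_))
    rw [mem_verticals₀] at hx
    rcases hx with ⟨-, -, h⟩ | ⟨-, -, h⟩ <;> linarith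
  induction n generalizing x with
  | zero => exact key 0 x h
  | succ n ih =>
    rcases h with h | h
    · exact key _ x h
    · obtain ⟨b, y, hy, rfl⟩ := mem_iUnion.1 h
      exact (ih hy).branch (spread_subset_zone verticals₀_subset_zone n hy) b

theorem gates_wall {n : ℕ} {x : ℂ} (h : x ∈ gates n) : HorizontalWall (table n) x := by
  induction n generalizing x with
  | zero => rw [table_zero]; exact gates₀_wall h
  | succ n ih =>
    obtain ⟨b, y, hy, rfl⟩ := mem_iUnion.1 h
    exact (ih hy).branch (gates_subset_zone n hy) b

theorem base_wall (n : ℕ) {x : ℝ} (h0 : 0 < x) (h1 : x < 1) :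
    Wall ((1 : ℝ) • Complex.imCLM) (table n) ⟨x, 0⟩ := by
  refine Wall.congr ?_ (eventually_mem_table_iff_of_low n (Or.inl (by norm_num)))
  filter_upwards [eventually_lt_re h0, eventually_re_lt h1,
    eventually_im_lt (show (⟨x, 0⟩ : ℂ).im < 1 by simp)] with z g1 g2 g3
  simp only [mem_table₀, smul_apply, Complex.imCLM_apply, Complex.sub_im,
    smul_eq_mul]
  exact ⟨by rintro (h | h) <;> linarith, fun h => Or.inl ⟨⟨by linarith, by linarith⟩, by linarith,
    by linarith⟩⟩

theorem base_horizontalWall (n : ℕ) {x : ℝ} (h0 : 0 < x) (h1 : x < 1) :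
    HorizontalWall (table n) ⟨x, 0⟩ := ⟨1, one_ne_zero, base_wall n h0 h1⟩

/-! ### The removed segments -/

theorem gates₀_subset_removed : gates₀ ⊆ removed 0 := by
  intro z hz
  rw [mem_gates₀] at hz
  rw [removed_zero]
  simp only [mem_iUnion, mem_branch_image, mem_base, unbranch_re, unbranch_im]
  rcases hz with ⟨h | h, h'⟩
  · refine ⟨false, ?_⟩
    simp only [shift]
    norm_num
    refine ⟨⟨?_, ?_⟩, ?_⟩ <;> linarith
  · refine ⟨true, ?_⟩
    simp only [shift]
    norm_num
    refine ⟨⟨?_, ?_⟩, ?_⟩ <;> linarith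

theorem gates_subset_removed (n : ℕ) : gates n ⊆ removed n := by
  induction n with
  | zero => exact gates₀_subset_removed
  | succ n ih =>
    rw [removed_succ]
    exact iUnion_mono fun b => image_mono ih

theorem removed_bounds {n : ℕ} {z : ℂ} (h : z ∈ removed n) :
    3 / 2 ≤ z.im ∧ -1 < z.re ∧ z.re < 2 := by
  induction n generalizing z with
  | zero =>
    rw [removed_zero] at h
    simp only [mem_iUnion, mem_branch_image, mem_base, unbranch_re, unbranch_im] at h
    obtain ⟨b, h1, h2⟩ := h
    rcases shift_cases b with ⟨-, e⟩ | ⟨-, e⟩ <;> rw [e] at h1 <;>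
      refine ⟨?_, ?_, ?_⟩ <;> linarith
  | succ n ih =>
    rw [removed_succ] at h
    simp only [mem_iUnion, mem_branch_image] at h
    obtain ⟨b, h⟩ := h
    have h1 := ih h
    simp only [unbranch_re, unbranch_im] at h1
    rcases shift_cases b with ⟨-, e⟩ | ⟨-, e⟩ <;> rw [e] at h1 <;>
      refine ⟨?_, ?_, ?_⟩ <;> linarith

/-- Segments removed at a positive level have height at least 9/4, out of reach of `A`; everything
else is compared inside one copy. This shows that no collision before the gate counts as an escape.
-/
theorem disjoint_spread_removed {A : Set ℂ} (hA : A ⊆ zone) (hA' : ∀ z ∈ A, z.im ≤ 3 / 2)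
    (h0 : Disjoint A (removed 0)) (n : ℕ) : Disjoint (spread A n) (removed n) := by
  induction n with
  | zero => exact h0
  | succ n ih =>
    rw [Set.disjoint_left]
    intro z hz hz'
    rw [removed_succ] at hz'
    simp only [mem_iUnion, mem_branch_image] at hz'
    obtain ⟨b, hz'⟩ := hz'
    have hb := removed_bounds hz'
    rcases hz with hz | hz
    · have := hA' z hz
      simp only [unbranch_im] at hb
      linarith
    · simp only [mem_iUnion, mem_branch_image] at hz
      obtain ⟨b', hz⟩ := hz
      have := eq_of_unbranch_mem_zone (spread_subset_zone hA n hz) hb.2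
      rw [this] at hz'
      exact Set.disjoint_left.1 ih hz hz'

theorem disjoint_horizontals_removed (n : ℕ) : Disjoint (horizontals n) (removed n) := by
  refine disjoint_spread_removed horizontals₀_subset_zone (fun z hz => ?_)
    (Set.disjoint_left.2 fun z hz hz' => ?_) n <;> rw [mem_horizontals₀] at hz
  · rcases hz with ⟨-, h⟩ | ⟨-, h⟩ <;> linarith
  · rw [removed_zero] at hz'
    simp only [mem_iUnion, mem_branch_image, mem_base, unbranch_re, unbranch_im] at hz'
    obtain ⟨b, h1, h2⟩ := hz'
    rcases hz with ⟨h, -⟩ | ⟨-, h⟩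
    · rcases shift_cases b with ⟨-, e⟩ | ⟨-, e⟩ <;> rw [e] at h1 <;> linarith
    · linarith

theorem disjoint_verticals_removed (n : ℕ) : Disjoint (verticals n) (removed n) := by
  refine disjoint_spread_removed verticals₀_subset_zone (fun z hz => ?_)
    (Set.disjoint_left.2 fun z hz hz' => ?_) n <;> rw [mem_verticals₀] at hz
  · rcases hz with ⟨-, -, h⟩ | ⟨-, -, h⟩ <;> linarith
  · have := (removed_bounds hz').1
    rcases hz with ⟨-, -, h⟩ | ⟨-, -, h⟩ <;> linarith

theorem Course.branch {n : ℕ} {z w : Phase} {S : Set ℂ} (b : Bool)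
    (h : Course (inside n) (horizontals n) (verticals n) z w S) :
    Course (inside (n + 1)) (horizontals (n + 1)) (verticals (n + 1))
      (branch b z.1, z.2) (branch b w.1, w.2) (branch b '' S) := by
  refine (h.image (f := TFractal.branch b) (r := 1 / 2) (by norm_num) fun x v => ?_).mono
    (branch_inside_subset n b) (branch_spread_subset _ n b) (branch_spread_subset _ n b)
  simp only [TFractal.branch]; push_cast; ring

theorem Course.of_zero {n : ℕ} {z w : Phase} {S : Set ℂ}
    (h : Course inside₀ horizontals₀ verticals₀ z w S) :
    Course (inside n) (horizontals n) (verticals n) z w S :=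
  h.mono (inside₀_subset_inside n) (subset_spread _ n) (subset_spread _ n)

/-! ### Crossing a rectangle -/

/-- The real line folded onto `[0, W]` by the reflections in the multiples of `W`. -/
noncomputable def fold (W u : ℝ) : ℝ := ‖(u : AddCircle (2 * W))‖

theorem fold_neg (W u : ℝ) : fold W (-u) = fold W u := by
  rw [fold, AddCircle.coe_neg, norm_neg, fold]

theorem fold_add_period (W u : ℝ) (k : ℤ) : fold W (u + 2 * W * k) = fold W u := by
  rw [fold, fold, mul_comm (2 * W), ← zsmul_eq_mul, AddCircle.coe_add, AddCircle.coe_zsmul,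
    AddCircle.coe_period, smul_zero, add_zero]

theorem fold_of_mem {W u : ℝ} (hW : 0 < W) (h0 : 0 ≤ u) (h1 : u ≤ W) : fold W u = u := by
  rw [fold, (AddCircle.norm_coe_eq_abs_iff (x := u) (2 * W) (by positivity)).2, abs_of_nonneg h0]
  rw [abs_of_nonneg h0, abs_of_pos (by positivity)]; linarith

/-- Folding is 1-Lipschitz, so parallel strands stay as close as their unfolded starting points. -/
theorem abs_fold_sub_le (W u u' : ℝ) : |fold W u - fold W u'| ≤ |u - u'| := by
  refine (abs_norm_sub_norm_le _ _).trans ?_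
  rw [← AddCircle.coe_sub]
  exact QuotientAddGroup.norm_mk_le_norm

theorem fold_nonneg (W u : ℝ) : 0 ≤ fold W u := norm_nonneg _

theorem fold_le {W : ℝ} (hW : 0 < W) (u : ℝ) : fold W u ≤ W := by
  have := AddCircle.norm_le_half_period (2 * W) (x := (u : AddCircle (2 * W))) (by positivity)
  rw [abs_of_pos (by positivity)] at this
  unfold fold; linarith

/-- The trace in the rectangle `[a, a + W] × [c, d]` of a line with inverse slope `ρ` that starts
at the unfolded abscissa `a + U`. -/
noncomputable def strand (a W c d U ρ : ℝ) : Set ℂ :=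
  (fun y : ℝ => (⟨a + fold W (U + ρ * (y - c)), y⟩ : ℂ)) '' Icc c d

/-- The unfolded position `U` and direction `σ` fold to the position `u` and direction `σ'`. -/
def FoldsTo (W U : ℝ) (σ : ℤˣ) (u : ℝ) (σ' : ℤˣ) : Prop :=
  ∃ k : ℤ, (U = u + 2 * W * k ∧ σ' = σ) ∨ (U = -u + 2 * W * k ∧ σ' = -σ)

namespace FoldsTo

variable {W U u u' : ℝ} {σ σ' σ'' : ℤˣ}

theorem symm (h : FoldsTo W U σ u σ') : FoldsTo W u σ' U σ := by
  obtain ⟨k, ⟨h, rfl⟩ | ⟨h, rfl⟩⟩ := h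
  · exact ⟨-k, Or.inl ⟨by push_cast; linarith, rfl⟩⟩
  · exact ⟨k, Or.inr ⟨by linarith, by simp⟩⟩

theorem trans (h : FoldsTo W U σ u σ') (h' : FoldsTo W u σ' u' σ'') : FoldsTo W U σ u' σ'' := by
  obtain ⟨k, ⟨h, rfl⟩ | ⟨h, rfl⟩⟩ := h <;> obtain ⟨l, ⟨h', rfl⟩ | ⟨h', rfl⟩⟩ := h'
  · exact ⟨k + l, Or.inl ⟨by push_cast; linarith, rfl⟩⟩
  · exact ⟨k + l, Or.inr ⟨by push_cast; linarith, rfl⟩⟩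
  · exact ⟨k - l, Or.inr ⟨by push_cast; linarith, rfl⟩⟩
  · exact ⟨k - l, Or.inl ⟨by push_cast; linarith, by simp⟩⟩

/-- A reflected position moves with the reflected orientation, so folding commutes with the motion.
-/
theorem add (h : FoldsTo W U σ u σ') (s : ℝ) :
    FoldsTo W (U + ((σ : ℤ) : ℝ) * s) σ (u + ((σ' : ℤ) : ℝ) * s) σ' := by
  obtain ⟨k, ⟨h, rfl⟩ | ⟨h, rfl⟩⟩ := h
  · exact ⟨k, Or.inl ⟨by linarith, rfl⟩⟩
  · exact ⟨k, Or.inr ⟨by push_cast; linarith, rfl⟩⟩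

theorem neg (h : FoldsTo W U σ u σ') : FoldsTo W U (-σ) u (-σ') := by
  obtain ⟨k, ⟨h, rfl⟩ | ⟨h, rfl⟩⟩ := h
  · exact ⟨k, Or.inl ⟨h, rfl⟩⟩
  · exact ⟨k, Or.inr ⟨h, rfl⟩⟩

theorem fold_eq (h : FoldsTo W U σ u σ') : fold W U = fold W u := by
  obtain ⟨k, ⟨rfl, -⟩ | ⟨rfl, -⟩⟩ := h
  · rw [fold_add_period]
  · rw [fold_add_period, fold_neg]

theorem strand_eq (h : FoldsTo W U σ u σ') (a c d p : ℝ) :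
    strand a W c d U (((σ : ℤ) : ℝ) * p) = strand a W c d u (((σ' : ℤ) : ℝ) * p) := by
  refine image_congr fun y _ => ?_
  rw [mul_assoc, mul_assoc, (h.add _).fold_eq]

/-- `[0, W]` is a fundamental domain of the group generated by the reflections in the multiples of
`W`, and no other point of it is equivalent to an interior point `u`. -/
theorem eq_of_mem (h : FoldsTo W U σ u σ') (hU0 : 0 ≤ U) (hU1 : U ≤ W) (h0 : 0 < u) (h1 : u < W) :
    U = u ∧ σ' = σ := by
  have hW : 0 < W := by linarith
  obtain ⟨k, ⟨h, h'⟩ | ⟨h, h'⟩⟩ := h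
  · have k1 : (-1 : ℝ) < k := by by_contra! hk; nlinarith
    have k2 : (k : ℝ) < 1 := by by_contra! hk; nlinarith
    have : k = 0 := by
      have k1' : (-1 : ℤ) < k := by exact_mod_cast k1
      have k2' : k < 1 := by exact_mod_cast k2
      omega
    subst this
    exact ⟨by simpa using h, h'⟩
  · exfalso
    have k1 : (0 : ℝ) < k := by by_contra! hk; nlinarith
    have k2 : (k : ℝ) < 1 := by by_contra! hk; nlinarith
    have k1' : (0 : ℤ) < k := by exact_mod_cast k1
    have k2' : k < 1 := by exact_mod_cast k2
    omega

end FoldsTo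

theorem strand_eq_segment {a W c d U ρ : ℝ} (hW : 0 < W) (hcd : c ≤ d)
    (h : ∀ y ∈ Icc c d, 0 ≤ U + ρ * (y - c) ∧ U + ρ * (y - c) ≤ W) :
    strand a W c d U ρ = segment ℝ ⟨a + U, c⟩ ⟨a + (U + ρ * (d - c)), d⟩ := by
  have := segment_ray ⟨a + U - ρ * c, 0⟩ ⟨ρ, 1⟩ hcd
  have e1 : (⟨a + U - ρ * c, 0⟩ : ℂ) + c * ⟨ρ, 1⟩ = ⟨a + U, c⟩ := by
    apply Complex.ext <;> simp; ring
  have e2 : (⟨a + U - ρ * c, 0⟩ : ℂ) + d * ⟨ρ, 1⟩ = ⟨a + (U + ρ * (d - c)), d⟩ := by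
    apply Complex.ext <;> simp; ring
  rw [e1, e2] at this
  rw [this]
  refine image_congr fun y hy => ?_
  rw [fold_of_mem hW (h y hy).1 (h y hy).2]
  apply Complex.ext <;> simp; ring

theorem strand_union {a W c m d U U' ρ ρ' : ℝ} (hcm : c ≤ m) (hmd : m ≤ d)
    (h : ∀ y, fold W (U + ρ * (y - c)) = fold W (U' + ρ' * (y - m))) :
    strand a W c d U ρ = strand a W c m U ρ ∪ strand a W m d U' ρ' := by
  have : strand a W m d U' ρ' =
      (fun y : ℝ => (⟨a + fold W (U + ρ * (y - c)), y⟩ : ℂ)) '' Icc m d :=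
    image_congr fun y _ => by rw [h]
  rw [this, strand, strand, ← image_union, Icc_union_Icc_eq_Icc hcm hmd]

/-- The upward direction with inverse slope `σ * p`. -/
noncomputable def heading (lam p : ℝ) (σ : ℤˣ) : ℂ := ⟨lam * (((σ : ℤ) : ℝ) * p), lam⟩

section crossing

variable {I H V : Set ℂ} {a W c d lam p : ℝ}

/-- Only the open flight has to avoid the vertical sides; its ends may lie on them, as they do
between two reflections. -/
theorem course_straight (hlam : 0 < lam) (hW : 0 < W)
    (hI : ∀ x y, a < x → x < a + W → c < y → y < d → (⟨x, y⟩ : ℂ) ∈ I)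
    {c' d' u u' : ℝ} {σ : ℤˣ} (hc : c ≤ c') (hcd : c' < d') (hd : d' ≤ d)
    (hu : u' = u + ((σ : ℤ) : ℝ) * p * (d' - c'))
    (h : ∀ y ∈ Ioo c' d', 0 < u + ((σ : ℤ) : ℝ) * p * (y - c') ∧
      u + ((σ : ℤ) : ℝ) * p * (y - c') < W) (h0 : 0 ≤ u ∧ u ≤ W) (h1 : 0 ≤ u' ∧ u' ≤ W) :
    Course I H V (⟨a + u, c'⟩, heading lam p σ) (⟨a + u', d'⟩, heading lam p σ)
      (strand a W c' d' u (((σ : ℤ) : ℝ) * p)) := by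
  rw [strand_eq_segment hW hcd.le]
  · rw [← hu]
    refine .flight (z := (⟨a + u, c'⟩, heading lam p σ)) (w := (⟨a + u', d'⟩, heading lam p σ))
      ((d' - c') / lam) (div_pos (by linarith) hlam) ?_ rfl fun s hs => ?_
    · apply Complex.ext
      · simp [heading, hu]; field_simp; ring
      · simp [heading]; field_simp; ring
    · have h2 : s * lam < d' - c' := by rw [← lt_div_iff₀ hlam]; exact hs.2
      have h3 : 0 < s * lam := mul_pos hs.1 hlam
      have h4 := h (c' + s * lam) ⟨by linarith, by linarith⟩
      have e : (⟨a + u, c'⟩ : ℂ) + s * heading lam p σ =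
          ⟨a + (u + ((σ : ℤ) : ℝ) * p * (c' + s * lam - c')), c' + s * lam⟩ := by
        apply Complex.ext <;> simp [heading]; ring
      simp only [e]
      exact hI _ _ (by linarith) (by linarith) (by linarith) (by linarith)
  · intro y hy
    rcases hy.1.eq_or_lt with rfl | h2
    · simpa using h0
    · rcases hy.2.eq_or_lt with rfl | h3
      · rw [← hu]; exact h1
      · exact ⟨(h y ⟨h2, h3⟩).1.le, (h y ⟨h2, h3⟩).2.le⟩

theorem reflV_heading (lam p : ℝ) (σ : ℤˣ) : reflV (heading lam p σ) = heading lam p (-σ) := by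
  simp [reflV, heading]

theorem reflH_heading (lam p : ℝ) (σ : ℤˣ) : reflH (heading lam p σ) = -heading lam p (-σ) := by
  simp [reflH, heading, Complex.ext_iff]

/-- Induction on a bound `N` for the number of reflections: the unfolded endpoint lies in `[-N W, W
+ N W]`, and unfolding afresh after a bounce lowers `N` by one. The conditions on `σ` allow a start
on a vertical side only if the ball moves away from it. -/
theorem course_cross_aux (hlam : 0 < lam) (hp : 0 < p) (hW : 0 < W)
    (hI : ∀ x y, a < x → x < a + W → c < y → y < d → (⟨x, y⟩ : ℂ) ∈ I)
    (hV : ∀ y, c < y → y < d → (⟨a, y⟩ : ℂ) ∈ V ∧ (⟨a + W, y⟩ : ℂ) ∈ V)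
    {u' : ℝ} {σ' : ℤˣ} (h0' : 0 < u') (h1' : u' < W) (N : ℕ) :
    ∀ {c' u : ℝ} {σ : ℤˣ}, c ≤ c' → c' < d → 0 ≤ u → u ≤ W → (σ = 1 → u < W) → (σ = -1 → 0 < u) →
      -(N * W) ≤ u + ((σ : ℤ) : ℝ) * p * (d - c') → u + ((σ : ℤ) : ℝ) * p * (d - c') ≤ W + N * W →
      FoldsTo W (u + ((σ : ℤ) : ℝ) * p * (d - c')) σ u' σ' →
      Course I H V (⟨a + u, c'⟩, heading lam p σ) (⟨a + u', d⟩, heading lam p σ')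
        (strand a W c' d u (((σ : ℤ) : ℝ) * p)) := by
  have straight : ∀ {c' u : ℝ} {σ : ℤˣ}, c ≤ c' → c' < d → 0 ≤ u → u ≤ W →
      0 ≤ u + ((σ : ℤ) : ℝ) * p * (d - c') → u + ((σ : ℤ) : ℝ) * p * (d - c') ≤ W →
      FoldsTo W (u + ((σ : ℤ) : ℝ) * p * (d - c')) σ u' σ' →
      Course I H V (⟨a + u, c'⟩, heading lam p σ) (⟨a + u', d⟩, heading lam p σ')
        (strand a W c' d u (((σ : ℤ) : ℝ) * p)) := by
    intro c' u σ hc hcd h0 h1 hU0 hU1 hf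
    obtain ⟨e, rfl⟩ := hf.eq_of_mem hU0 hU1 h0' h1'
    refine course_straight hlam hW hI hc hcd le_rfl e.symm (fun y hy => ?_) ⟨h0, h1⟩
      ⟨h0'.le, h1'.le⟩
    have hy1 : 0 < p * (y - c') := mul_pos hp (by linarith [hy.1])
    have hy2 : p * (y - c') < p * (d - c') := mul_lt_mul_of_pos_left (by linarith [hy.2]) hp
    rcases Int.units_eq_one_or σ' with rfl | rfl <;> push_cast at e ⊢ <;>
      constructor <;> linarith
  induction N with
  | zero =>
    intro c' u σ hc hcd h0 h1 _ _ hU0 hU1 hf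
    exact straight hc hcd h0 h1 (by simpa using hU0) (by simpa using hU1) hf
  | succ N ih =>
    intro c' u σ hc hcd h0 h1 hs1 hs2 hU0 hU1 hf
    have hNW : 0 ≤ (N : ℝ) * W := by positivity
    have hpd : 0 < p * (d - c') := mul_pos hp (by linarith)
    push_cast at hU0 hU1
    rcases lt_or_ge W (u + ((σ : ℤ) : ℝ) * p * (d - c')) with hr | hr
    · obtain rfl : σ = 1 := by
        rcases Int.units_eq_one_or σ with rfl | rfl
        · rfl
        · exfalso; push_cast at hr; linarith
      have hu := hs1 rfl
      -- The height at which the ball reaches the right-hand side.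
      set c'' := c' + (W - u) / p with hc''
      have e1 : p * (c'' - c') = W - u := by rw [hc'']; field_simp; ring
      push_cast at hr hU0 hU1
      have h2 : c' < c'' := by rw [hc'']; linarith [div_pos (sub_pos.2 hu) hp]
      have h3 : c'' < d := by
        have : p * (c'' - c') < p * (d - c') := by linarith
        linarith [lt_of_mul_lt_mul_left this hp.le]
      have e2 : p * (d - c'') = p * (d - c') - (W - u) := by rw [← e1]; ring
      have hA := course_straight (H := H) (V := V) (σ := 1) (p := p) (u := u) (u' := W) hlam hW hI hc h2 h3.le
        (by push_cast; linarith) (fun y hy => by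
          have hy1 : 0 < p * (y - c') := mul_pos hp (by linarith [hy.1])
          have hy2 : p * (y - c') < p * (c'' - c') :=
            mul_lt_mul_of_pos_left (by linarith [hy.2]) hp
          push_cast; constructor <;> linarith) ⟨h0, h1⟩ ⟨hW.le, le_rfl⟩
      have hB := ih (c' := c'') (u := W) (σ := -1) (by linarith) h3 hW.le le_rfl (fun h => absurd h (by decide))
        (fun _ => hW) (by push_cast; linarith) (by push_cast; linarith) (by
          -- The bounce replaces the unfolded endpoint `E` by `2 W - E`, which turns the index `k`
          -- into `1 - k` and exchanges the two alternatives.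
          obtain ⟨k, ⟨hk, hk'⟩ | ⟨hk, hk'⟩⟩ := hf
          · exact ⟨1 - k, Or.inr ⟨by push_cast at hk ⊢; linarith, by simp [hk']⟩⟩
          · exact ⟨1 - k, Or.inl ⟨by push_cast at hk ⊢; linarith, by simp [hk']⟩⟩)
      rw [strand_union (m := c'') (U' := W) (ρ' := (((-1 : ℤˣ) : ℤ) : ℝ) * p) h2.le h3.le]
      · refine .vertical hA (hV _ (by linarith) h3).2 ?_
        rw [reflV_heading]; exact hB
      · intro y
        rw [← fold_neg, ← fold_add_period _ _ 1]
        congr 1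
        push_cast; linarith
    · rcases lt_or_ge (u + ((σ : ℤ) : ℝ) * p * (d - c')) 0 with hl | hl
      · obtain rfl : σ = -1 := by
          rcases Int.units_eq_one_or σ with rfl | rfl
          · exfalso; push_cast at hl; linarith
          · rfl
        have hu := hs2 rfl
        set c'' := c' + u / p with hc''
        have e1 : p * (c'' - c') = u := by rw [hc'']; field_simp; ring
        push_cast at hl hU0 hU1
        have h2 : c' < c'' := by rw [hc'']; linarith [div_pos hu hp]
        have h3 : c'' < d := by
          have : p * (c'' - c') < p * (d - c') := by linarith
          linarith [lt_of_mul_lt_mul_left this hp.le]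
        have e2 : p * (d - c'') = p * (d - c') - u := by rw [← e1]; ring
        have hA := course_straight (H := H) (V := V) (σ := -1) (p := p) (u := u) (u' := 0) hlam hW hI hc h2 h3.le
          (by push_cast; linarith) (fun y hy => by
            have hy1 : 0 < p * (y - c') := mul_pos hp (by linarith [hy.1])
            have hy2 : p * (y - c') < p * (c'' - c') :=
              mul_lt_mul_of_pos_left (by linarith [hy.2]) hp
            push_cast; constructor <;> linarith) ⟨h0, h1⟩ ⟨le_rfl, hW.le⟩
        have hB := ih (c' := c'') (u := 0) (σ := 1) (by linarith) h3 le_rfl hW.le (fun _ => hW)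
          (by decide) (by push_cast; linarith) (by push_cast; linarith) (by
            obtain ⟨k, ⟨hk, hk'⟩ | ⟨hk, hk'⟩⟩ := hf
            · exact ⟨-k, Or.inr ⟨by push_cast at hk ⊢; linarith, by simp [hk']⟩⟩
            · exact ⟨-k, Or.inl ⟨by push_cast at hk ⊢; linarith, by simp [hk']⟩⟩)
        rw [strand_union (m := c'') (U' := 0) (ρ' := (((1 : ℤˣ) : ℤ) : ℝ) * p) h2.le h3.le]
        · refine .vertical hA (by simpa using (hV _ (by linarith) h3).1) ?_
          rw [reflV_heading, neg_neg]; exact hB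
        · intro y
          rw [← fold_neg]
          congr 1
          push_cast; linarith
      · exact straight hc hcd h0 h1 hl hr hf

/-- The upward crossing of a rectangle by a ball that is reflected at the vertical sides. -/
theorem course_cross (hlam : 0 < lam) (hp : 0 < p) (hW : 0 < W) (hcd : c < d)
    (hI : ∀ x y, a < x → x < a + W → c < y → y < d → (⟨x, y⟩ : ℂ) ∈ I)
    (hV : ∀ y, c < y → y < d → (⟨a, y⟩ : ℂ) ∈ V ∧ (⟨a + W, y⟩ : ℂ) ∈ V)
    {U u u' : ℝ} {σ₀ σ σ' : ℤˣ} (h0 : 0 < u) (h1 : u < W) (h0' : 0 < u') (h1' : u' < W)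
    (h : FoldsTo W U σ₀ u σ) (h' : FoldsTo W (U + ((σ₀ : ℤ) : ℝ) * p * (d - c)) σ₀ u' σ') :
    Course I H V (⟨a + u, c⟩, heading lam p σ) (⟨a + u', d⟩, heading lam p σ')
      (strand a W c d U (((σ₀ : ℤ) : ℝ) * p)) := by
  rw [h.strand_eq]
  have h2 : FoldsTo W (u + ((σ : ℤ) : ℝ) * p * (d - c)) σ u' σ' := by
    have := h.symm.add (p * (d - c))
    rw [← mul_assoc, ← mul_assoc] at this
    exact this.trans h'
  obtain ⟨N, hN⟩ := exists_nat_ge (p * (d - c) / W)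
  rw [div_le_iff₀ hW] at hN
  have hpd : 0 < p * (d - c) := mul_pos hp (by linarith)
  refine course_cross_aux hlam hp hW hI hV h0' h1' N le_rfl hcd h0.le h1.le (fun _ => h1)
    (fun _ => h0) ?_ ?_ h2 <;> rcases Int.units_eq_one_or σ with rfl | rfl <;> push_cast <;> linarith

end crossing

/-! ### The ascent through the initial table -/

/-- Whether a ball that starts upwards with inverse slope `σ * p` leaves the initial table through
the gate on the right. -/
def rightward (p : ℕ) (σ : ℤˣ) : Bool := decide (4 < ((σ : ℤ) * p) % 8)

open Classical in
/-- Where in its copy of the table the ball arrives. -/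
noncomputable def entryPoint (p : ℕ) (σ : ℤˣ) (x : ℝ) : ℝ :=
  if x < 1 / 2 then (if rightward p σ then 1 - 2 * x else 2 * x)
  else if rightward p σ then 2 * x - 1 else 2 - 2 * x

open Classical in
/-- The horizontal orientation with which the ball enters its copy of the table. -/
noncomputable def entrySign (p : ℕ) (σ : ℤˣ) (x : ℝ) : ℤˣ :=
  if x < 1 / 2 ↔ rightward p σ then -σ else σ

/-- Whether the ball leaves the initial table when it first reaches its top. -/
def Direct (p : ℕ) (σ : ℤˣ) (x : ℝ) : Prop := ((σ : ℤ) * p) % 4 = 1 ↔ 1 / 2 ≤ x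

open Classical in
/-- The path of the ball until it leaves the initial table. -/
noncomputable def ascentPath (p : ℕ) (σ : ℤˣ) (x : ℝ) : Set ℂ :=
  strand 0 1 0 1 x (((σ : ℤ) : ℝ) * p) ∪
    (strand (-1 / 2) 2 1 (3 / 2) (3 / 2 - x) ((((-σ : ℤˣ) : ℤ) : ℝ) * p) ∪
      if Direct p σ x then ∅ else
        strand (-1 / 2) 2 1 (3 / 2) (3 / 2 - x - ((σ : ℤ) : ℝ) * p) (((σ : ℤ) : ℝ) * p) ∪
        strand (-1 / 2) 2 1 (3 / 2) (3 / 2 - x - ((σ : ℤ) : ℝ) * p) ((((-σ : ℤˣ) : ℤ) : ℝ) * p))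

section ascent

variable {p : ℕ} {lam : ℝ} {σ : ℤˣ} {x : ℝ}

/-- The horizontal displacement is the odd number `± p` and the folding period is 2, so `x ± p`
folds to `1 - x` with reversed orientation. -/
theorem course_square (hlam : 0 < lam) (hp : Odd p) (h0 : 0 < x) (h1 : x < 1) :
    Course inside₀ horizontals₀ verticals₀ (⟨x, 0⟩, heading lam p σ) (⟨1 - x, 1⟩, heading lam p (-σ))
      (strand 0 1 0 1 x (((σ : ℤ) : ℝ) * p)) := by
  have hp0 : (0 : ℝ) < p := by exact_mod_cast hp.pos
  have := course_cross (I := inside₀) (H := horizontals₀) (V := verticals₀) (a := 0) (W := 1)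
    (c := 0) (d := 1) (U := x) (u := x) (u' := 1 - x) (σ₀ := σ) (σ := σ) (σ' := -σ) hlam hp0 one_pos
    one_pos (fun x y h1 h2 h3 h4 => mem_inside₀.2 (Or.inl ⟨⟨h1, by simpa using h2⟩, h3, h4.le⟩))
    (fun y h1 h2 => ⟨mem_verticals₀.2 (Or.inl ⟨Or.inl rfl, h1, h2⟩),
      mem_verticals₀.2 (Or.inl ⟨Or.inr (by norm_num), h1, h2⟩)⟩) h0 h1 (by linarith) (by linarith)
    ⟨0, Or.inl ⟨by simp, rfl⟩⟩ (by
      obtain ⟨m, rfl⟩ := hp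
      rcases Int.units_eq_one_or σ with rfl | rfl
      · exact ⟨m + 1, Or.inr ⟨by push_cast; ring, rfl⟩⟩
      · exact ⟨-m, Or.inr ⟨by push_cast; ring, rfl⟩⟩)
  simpa only [zero_add] using this

theorem course_cap (hlam : 0 < lam) (hp : Odd p) {U u u' : ℝ} {σ₀ σ σ' : ℤˣ} (h0 : 0 < u)
    (h1 : u < 2) (h0' : 0 < u') (h1' : u' < 2) (h : FoldsTo 2 U σ₀ u σ)
    (h' : FoldsTo 2 (U + ((σ₀ : ℤ) : ℝ) * p * (3 / 2 - 1)) σ₀ u' σ') :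
    Course inside₀ horizontals₀ verticals₀ (⟨-1 / 2 + u, 1⟩, heading lam p σ)
      (⟨-1 / 2 + u', 3 / 2⟩, heading lam p σ')
      (strand (-1 / 2) 2 1 (3 / 2) U (((σ₀ : ℤ) : ℝ) * p)) := by
  have hp0 : (0 : ℝ) < p := by exact_mod_cast hp.pos
  exact course_cross (I := inside₀) (H := horizontals₀) (V := verticals₀) (a := -1 / 2) (W := 2)
    (c := 1) (d := 3 / 2) hlam hp0 two_pos (by norm_num)
    (fun x y h1 h2 h3 h4 => mem_inside₀.2 (Or.inr ⟨⟨h1, by linarith⟩, h3, h4⟩))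
    (fun y h1 h2 => ⟨mem_verticals₀.2 (Or.inr ⟨Or.inl rfl, h1, h2⟩),
      mem_verticals₀.2 (Or.inr ⟨Or.inr (by norm_num), h1, h2⟩)⟩) h0 h1 h0' h1' h h'

theorem course_direct (hlam : 0 < lam) (hp : Odd p) (h0 : 0 < x) (h1 : x < 1) (hd : Direct p σ x)
    {u : ℝ} {σ' : ℤˣ} (hu0 : 0 < u) (hu1 : u < 2)
    (h : FoldsTo 2 (3 / 2 - x - ((σ : ℤ) : ℝ) * p / 2) (-σ) u σ') :
    Course inside₀ horizontals₀ verticals₀ (⟨x, 0⟩, heading lam p σ)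
      (⟨-1 / 2 + u, 3 / 2⟩, heading lam p σ') (ascentPath p σ x) := by
  rw [ascentPath, if_pos hd, union_empty]
  refine .pass (course_square hlam hp h0 h1)
    (mem_inside₀.2 (Or.inl ⟨⟨by simp; linarith, by simp; linarith⟩, by norm_num, by norm_num⟩)) ?_
  have := course_cap (U := 3 / 2 - x) (u := 3 / 2 - x) (σ₀ := -σ) (σ := -σ) hlam hp (by linarith)
    (by linarith) hu0 hu1 ⟨0, Or.inl ⟨by simp, rfl⟩⟩ (by
      convert h using 1; push_cast; ring)
  rwa [show -1 / 2 + (3 / 2 - x) = 1 - x by ring] at this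

/-- The ball meets the top between the gates at `u₁`, falls to a ledge at `u₂`, and climbs again to
`u₃`. Each crossing of the cap displaces the unfolded abscissa by another `-σ * p / 2`. The fall is
obtained as the time reversal of an upward crossing from `u₂`. -/
theorem course_indirect (hlam : 0 < lam) (hp : Odd p) (h0 : 0 < x) (h1 : x < 1)
    (hd : ¬Direct p σ x) {u₁ u₂ u₃ : ℝ} {σ₁ σ₃ : ℤˣ} (hu₁ : 1 / 2 < u₁ ∧ u₁ < 3 / 2)
    (hu₂ : (0 < u₂ ∧ u₂ < 1 / 2) ∨ (3 / 2 < u₂ ∧ u₂ < 2)) (hu₃ : 0 < u₃ ∧ u₃ < 2)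
    (hf₁ : FoldsTo 2 (3 / 2 - x - ((σ : ℤ) : ℝ) * p / 2) (-σ) u₁ σ₁)
    (hf₂ : FoldsTo 2 (3 / 2 - x - ((σ : ℤ) : ℝ) * p) (-σ) u₂ (-σ))
    (hf₃ : FoldsTo 2 (3 / 2 - x - 3 * (((σ : ℤ) : ℝ) * p) / 2) (-σ) u₃ σ₃) :
    Course inside₀ horizontals₀ verticals₀ (⟨x, 0⟩, heading lam p σ)
      (⟨-1 / 2 + u₃, 3 / 2⟩, heading lam p σ₃) (ascentPath p σ x) := by
  rw [ascentPath, if_neg hd]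
  have hu₂0 : 0 < u₂ := by rcases hu₂ with h | h <;> linarith
  have hu₂2 : u₂ < 2 := by rcases hu₂ with h | h <;> linarith
  refine .pass (course_square hlam hp h0 h1)
    (mem_inside₀.2 (Or.inl ⟨⟨by simp; linarith, by simp; linarith⟩, by norm_num, by norm_num⟩)) ?_
  have hB := course_cap (U := 3 / 2 - x) (u := 3 / 2 - x) (σ₀ := -σ) (σ := -σ) hlam hp
    (by linarith) (by linarith) (by linarith) (by linarith) ⟨0, Or.inl ⟨by simp, rfl⟩⟩
    (show FoldsTo 2 _ _ u₁ σ₁ by convert hf₁ using 1; push_cast; ring)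
  have hC := (course_cap (σ₀ := σ) (u := u₂) (σ := σ) (u' := u₁) (σ' := -σ₁) hlam hp hu₂0 hu₂2
    (by linarith) (by linarith) (by simpa using hf₂.neg)
    (by convert hf₁.neg using 1 <;> [ring; simp])).reverse
  have hD := course_cap (σ₀ := -σ) (u := u₂) (σ := -σ) (u' := u₃) (σ' := σ₃) hlam hp hu₂0 hu₂2
    hu₃.1 hu₃.2 hf₂ (by convert hf₃ using 1; push_cast; ring)
  have e : (⟨1 - x, 1⟩ : ℂ) = ⟨-1 / 2 + (3 / 2 - x), 1⟩ := by
    apply Complex.ext <;> simp; ring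
  rw [e]
  refine .horizontal hB (mem_horizontals₀.2 (Or.inl ⟨⟨by simp; linarith, by simp; linarith⟩, rfl⟩)) ?_
  rw [reflH_heading]
  refine .horizontal hC (mem_horizontals₀.2 (Or.inr ⟨?_, rfl⟩)) ?_
  · rcases hu₂ with h | h
    · exact Or.inl ⟨by simp; linarith, by simp; linarith⟩
    · exact Or.inr ⟨by simp; linarith, by simp; linarith⟩
  · convert hD using 2
    simp [reflH, heading]

/-- The cases are the residue of `σ * p` modulo 8 and the half of the base that contains `x`. The
excluded `x = 1/2` would lead to an end point of a gate. -/
theorem course_ascent (hlam : 0 < lam) (hp : Odd p) (h0 : 0 < x) (h1 : x < 1) (hx : x ≠ 1 / 2) :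
    Course inside₀ horizontals₀ verticals₀ (⟨x, 0⟩, heading lam p σ)
      (branch (rightward p σ) ⟨entryPoint p σ x, 0⟩, heading lam p (entrySign p σ x))
      (ascentPath p σ x) := by
  -- Crossing the cap displaces the ball by half of `σ * p`, and the folding period there is 4, so
  -- only the residue modulo 8 matters; it is odd.
  obtain ⟨m, j, hr, hj⟩ : ∃ m j : ℤ, (σ : ℤ) * p = 8 * m + j ∧ (j = 1 ∨ j = 3 ∨ j = 5 ∨ j = 7) := by
    refine ⟨(σ : ℤ) * p / 8, (σ : ℤ) * p % 8, by omega, ?_⟩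
    obtain ⟨k, rfl⟩ := hp
    rcases Int.units_eq_one_or σ with rfl | rfl <;> push_cast <;> omega
  have hr' : ((σ : ℤ) : ℝ) * p = 8 * m + j := by exact_mod_cast hr
  have e : branch (rightward p σ) ⟨entryPoint p σ x, 0⟩ =
      ⟨-1 / 2 + (entryPoint p σ x / 2 + shift (rightward p σ) + 1 / 2), 3 / 2⟩ := by
    apply Complex.ext <;> simp; ring
  rw [e]
  have fin : ∀ {u : ℝ} {s : ℤˣ}, entryPoint p σ x / 2 + shift (rightward p σ) + 1 / 2 = u →
      entrySign p σ x = s → Course inside₀ horizontals₀ verticals₀ (⟨x, 0⟩, heading lam p σ)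
        (⟨-1 / 2 + u, 3 / 2⟩, heading lam p s) (ascentPath p σ x) →
      Course inside₀ horizontals₀ verticals₀ (⟨x, 0⟩, heading lam p σ)
        (⟨-1 / 2 + (entryPoint p σ x / 2 + shift (rightward p σ) + 1 / 2), 3 / 2⟩,
          heading lam p (entrySign p σ x)) (ascentPath p σ x) := by
    rintro u s rfl rfl h; exact h
  rcases lt_or_gt_of_ne hx with hlt | hgt
  · have hx₁ : x < 1 / 2 := hlt
    have hx₂ : ¬(1 / 2 ≤ x) := not_le.2 hlt
    rcases hj with rfl | rfl | rfl | rfl <;> push_cast at hr'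
    · have hR : rightward p σ = false := by unfold rightward; rw [hr]; simp
      have h4 : ((σ : ℤ) * p) % 4 = 1 := by omega
      have hD : ¬Direct p σ x := by rw [Direct]; tauto
      refine fin (u := x) (s := σ) (by simp only [entryPoint, hR, hx₁, shift]; norm_num)
        (by simp only [entrySign, hR, hx₁]; simp) ?_
      exact course_indirect hlam hp h0 h1 hD (u₁ := 1 - x) (u₂ := 1 / 2 - x) (σ₁ := -σ)
        ⟨by linarith, by linarith⟩ (Or.inl ⟨by linarith, by linarith⟩) ⟨by linarith, by linarith⟩
        ⟨-m, Or.inl ⟨by rw [hr']; push_cast; ring, rfl⟩⟩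
        ⟨-2 * m, Or.inl ⟨by rw [hr']; push_cast; ring, rfl⟩⟩
        ⟨-3 * m, Or.inr ⟨by rw [hr']; push_cast; ring, (neg_neg σ).symm⟩⟩
    · have hR : rightward p σ = false := by unfold rightward; rw [hr]; simp
      have h4 : ¬(((σ : ℤ) * p) % 4 = 1) := by omega
      have hD : Direct p σ x := by rw [Direct]; tauto
      refine fin (u := x) (s := σ) (by simp only [entryPoint, hR, hx₁, shift]; norm_num)
        (by simp only [entrySign, hR, hx₁]; simp) ?_
      exact course_direct hlam hp h0 h1 hD (by linarith) (by linarith)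
        ⟨-m, Or.inr ⟨by rw [hr']; push_cast; ring, (neg_neg σ).symm⟩⟩
    · have hR : rightward p σ = true := by unfold rightward; rw [hr]; simp
      have h4 : ((σ : ℤ) * p) % 4 = 1 := by omega
      have hD : ¬Direct p σ x := by rw [Direct]; tauto
      refine fin (u := 2 - x) (s := -σ) (by simp only [entryPoint, hR, hx₁, shift]; norm_num; ring)
        (by simp only [entrySign, hR, hx₁]; simp) ?_
      exact course_indirect hlam hp h0 h1 hD (u₁ := 1 + x) (u₂ := 1 / 2 - x) (σ₁ := σ)
        ⟨by linarith, by linarith⟩ (Or.inl ⟨by linarith, by linarith⟩) ⟨by linarith, by linarith⟩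
        ⟨-m, Or.inr ⟨by rw [hr']; push_cast; ring, (neg_neg σ).symm⟩⟩
        ⟨-2 * m - 1, Or.inl ⟨by rw [hr']; push_cast; ring, rfl⟩⟩
        ⟨-3 * m - 2, Or.inl ⟨by rw [hr']; push_cast; ring, rfl⟩⟩
    · have hR : rightward p σ = true := by unfold rightward; rw [hr]; simp
      have h4 : ¬(((σ : ℤ) * p) % 4 = 1) := by omega
      have hD : Direct p σ x := by rw [Direct]; tauto
      refine fin (u := 2 - x) (s := -σ) (by simp only [entryPoint, hR, hx₁, shift]; norm_num; ring)
        (by simp only [entrySign, hR, hx₁]; simp) ?_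
      exact course_direct hlam hp h0 h1 hD (by linarith) (by linarith)
        ⟨-m - 1, Or.inl ⟨by rw [hr']; push_cast; ring, rfl⟩⟩
  · have hx₁ : ¬(x < 1 / 2) := not_lt.2 hgt.le
    have hx₂ : 1 / 2 ≤ x := hgt.le
    rcases hj with rfl | rfl | rfl | rfl <;> push_cast at hr'
    · have hR : rightward p σ = false := by unfold rightward; rw [hr]; simp
      have h4 : ((σ : ℤ) * p) % 4 = 1 := by omega
      have hD : Direct p σ x := by rw [Direct]; tauto
      refine fin (u := 1 - x) (s := -σ) (by simp only [entryPoint, hR, hx₁, shift]; norm_num; ring)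
        (by simp only [entrySign, hR, hx₁]; simp) ?_
      exact course_direct hlam hp h0 h1 hD (by linarith) (by linarith)
        ⟨-m, Or.inl ⟨by rw [hr']; push_cast; ring, rfl⟩⟩
    · have hR : rightward p σ = false := by unfold rightward; rw [hr]; simp
      have h4 : ¬(((σ : ℤ) * p) % 4 = 1) := by omega
      have hD : ¬Direct p σ x := by rw [Direct]; tauto
      refine fin (u := 1 - x) (s := -σ) (by simp only [entryPoint, hR, hx₁, shift]; norm_num; ring)
        (by simp only [entrySign, hR, hx₁]; simp) ?_
      exact course_indirect hlam hp h0 h1 hD (u₁ := x) (u₂ := 5 / 2 - x) (σ₁ := σ)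
        ⟨by linarith, by linarith⟩ (Or.inr ⟨by linarith, by linarith⟩) ⟨by linarith, by linarith⟩
        ⟨-m, Or.inr ⟨by rw [hr']; push_cast; ring, (neg_neg σ).symm⟩⟩
        ⟨-2 * m - 1, Or.inl ⟨by rw [hr']; push_cast; ring, rfl⟩⟩
        ⟨-3 * m - 1, Or.inl ⟨by rw [hr']; push_cast; ring, rfl⟩⟩
    · have hR : rightward p σ = true := by unfold rightward; rw [hr]; simp
      have h4 : ((σ : ℤ) * p) % 4 = 1 := by omega
      have hD : Direct p σ x := by rw [Direct]; tauto
      refine fin (u := 1 + x) (s := σ) (by simp only [entryPoint, hR, hx₁, shift]; norm_num; ring)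
        (by simp only [entrySign, hR, hx₁]; simp) ?_
      exact course_direct hlam hp h0 h1 hD (by linarith) (by linarith)
        ⟨-m, Or.inr ⟨by rw [hr']; push_cast; ring, (neg_neg σ).symm⟩⟩
    · have hR : rightward p σ = true := by unfold rightward; rw [hr]; simp
      have h4 : ¬(((σ : ℤ) * p) % 4 = 1) := by omega
      have hD : ¬Direct p σ x := by rw [Direct]; tauto
      refine fin (u := 1 + x) (s := σ) (by simp only [entryPoint, hR, hx₁, shift]; norm_num; ring)
        (by simp only [entrySign, hR, hx₁]; simp) ?_
      exact course_indirect hlam hp h0 h1 hD (u₁ := 2 - x) (u₂ := 5 / 2 - x) (σ₁ := -σ)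
        ⟨by linarith, by linarith⟩ (Or.inr ⟨by linarith, by linarith⟩) ⟨by linarith, by linarith⟩
        ⟨-m - 1, Or.inl ⟨by rw [hr']; push_cast; ring, rfl⟩⟩
        ⟨-2 * m - 2, Or.inl ⟨by rw [hr']; push_cast; ring, rfl⟩⟩
        ⟨-3 * m - 2, Or.inr ⟨by rw [hr']; push_cast; ring, (neg_neg σ).symm⟩⟩

end ascent

/-! ### The ascent through the prefractal tables -/

/-- `x` is a point of `(0, 1)` that is not a dyadic rational. -/
def NonDyadic (x : ℝ) : Prop := (0 < x ∧ x < 1) ∧ ∀ (m : ℤ) (l : ℕ), x * 2 ^ l ≠ m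

namespace NonDyadic

variable {x : ℝ}

theorem ne_half (h : NonDyadic x) : x ≠ 1 / 2 := by
  rintro rfl
  exact h.2 1 1 (by norm_num)

theorem one_sub (h : NonDyadic x) : NonDyadic (1 - x) := by
  refine ⟨⟨by linarith [h.1.2], by linarith [h.1.1]⟩, fun m l hm => h.2 (2 ^ l - m) l ?_⟩
  push_cast; linarith

theorem double (h : NonDyadic x) (hx : x < 1 / 2) : NonDyadic (2 * x) := by
  refine ⟨⟨by linarith [h.1.1], by linarith⟩, fun m l hm => h.2 m (l + 1) ?_⟩
  rw [← hm, pow_succ]; ring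

theorem double_sub_one (h : NonDyadic x) (hx : 1 / 2 ≤ x) : NonDyadic (2 * x - 1) := by
  have := (h.one_sub.double (by linarith [lt_of_le_of_ne hx h.ne_half.symm])).one_sub
  rwa [show 1 - 2 * (1 - x) = 2 * x - 1 by ring] at this

theorem half (h : NonDyadic x) : NonDyadic (x / 2) := by
  refine ⟨⟨by linarith [h.1.1], by linarith [h.1.1, h.1.2]⟩, fun m l hm => h.2 (2 * m) l ?_⟩
  push_cast; linarith

theorem half_add (h : NonDyadic x) : NonDyadic ((1 + x) / 2) := by
  have := h.one_sub.half.one_sub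
  rwa [show 1 - (1 - x) / 2 = (1 + x) / 2 by ring] at this

/-- Up to a reflection of the interval this is the doubling map, so the hypothesis on `x` survives
at every level. -/
theorem entryPoint (h : NonDyadic x) (p : ℕ) (σ : ℤˣ) : NonDyadic (entryPoint p σ x) := by
  unfold TFractal.entryPoint
  split_ifs with h1 h2 h2
  · exact (h.double h1).one_sub
  · exact h.double h1
  · exact h.double_sub_one (not_lt.1 h1)
  · have := (h.double_sub_one (not_lt.1 h1)).one_sub
    rwa [show 1 - (2 * x - 1) = 2 - 2 * x by ring] at this

end NonDyadic

/-- The reflection of a point in the midpoint of the dyadic interval of length `2⁻ⁿ` around it. -/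
noncomputable def mirror : ℕ → ℝ → ℝ
  | 0, x => 1 - x
  | n + 1, x => if x < 1 / 2 then mirror n (2 * x) / 2 else (1 + mirror n (2 * x - 1)) / 2

theorem mirror_succ_of_lt (n : ℕ) {x : ℝ} (h : x < 1 / 2) :
    mirror (n + 1) x = mirror n (2 * x) / 2 := if_pos h

theorem mirror_succ_of_le (n : ℕ) {x : ℝ} (h : 1 / 2 ≤ x) :
    mirror (n + 1) x = (1 + mirror n (2 * x - 1)) / 2 := if_neg (not_lt.2 h)

theorem NonDyadic.mirror {x : ℝ} (h : NonDyadic x) (n : ℕ) : NonDyadic (mirror n x) := by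
  induction n generalizing x with
  | zero => exact h.one_sub
  | succ n ih =>
    rcases lt_or_ge x (1 / 2) with hx | hx
    · rw [mirror_succ_of_lt n hx]; exact (ih (h.double hx)).half
    · rw [mirror_succ_of_le n hx]; exact (ih (h.double_sub_one hx)).half_add

/-- The midpoint reflection at level `n + 1` keeps the first binary digit, the only one on which the
ascent through the initial table depends combinatorially. -/
theorem mirror_succ_lt_iff {x : ℝ} (h : NonDyadic x) (n : ℕ) :
    mirror (n + 1) x < 1 / 2 ↔ x < 1 / 2 := by
  rcases lt_or_ge x (1 / 2) with hx | hx
  · rw [mirror_succ_of_lt n hx]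
    have := ((h.double hx).mirror n).1.2
    exact ⟨fun _ => hx, fun _ => by linarith⟩
  · rw [mirror_succ_of_le n hx]
    have := ((h.double_sub_one hx).mirror n).1.1
    exact ⟨fun _ => by linarith, fun h' => by linarith⟩

theorem mirror_mirror {x : ℝ} (h : NonDyadic x) (n : ℕ) : mirror n (mirror n x) = x := by
  induction n generalizing x with
  | zero => simp [mirror]
  | succ n ih =>
    have hi := mirror_succ_lt_iff h n
    rcases lt_or_ge x (1 / 2) with hx | hx
    · rw [mirror_succ_of_lt n (hi.2 hx), mirror_succ_of_lt n hx, mul_div_cancel₀ _ two_ne_zero,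
        ih (h.double hx)]
      ring
    · rw [mirror_succ_of_le n (not_lt.1 (hi.not.2 (not_lt.2 hx))), mirror_succ_of_le n hx,
        mul_div_cancel₀ _ two_ne_zero, add_sub_cancel_left, ih (h.double_sub_one hx)]
      ring

theorem mirror_one_sub {x : ℝ} (h : NonDyadic x) (n : ℕ) : mirror n (1 - x) = 1 - mirror n x := by
  induction n generalizing x with
  | zero => simp [mirror]
  | succ n ih =>
    rcases lt_or_gt_of_ne h.ne_half with hx | hx
    · rw [mirror_succ_of_le n (by linarith), mirror_succ_of_lt n hx,
        show 2 * (1 - x) - 1 = 1 - 2 * x by ring, ih (h.double hx)]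
      ring
    · rw [mirror_succ_of_lt n (by linarith), mirror_succ_of_le n hx.le,
        show 2 * (1 - x) = 1 - (2 * x - 1) by ring, ih (h.double_sub_one hx.le)]
      ring

theorem abs_mirror_sub_le {x : ℝ} (h : NonDyadic x) (n : ℕ) : |mirror n x - x| ≤ (1 / 2) ^ n := by
  induction n generalizing x with
  | zero =>
    simp only [mirror, pow_zero, abs_le]
    constructor <;> linarith [h.1.1, h.1.2]
  | succ n ih =>
    rw [pow_succ]
    rcases lt_or_ge x (1 / 2) with hx | hx
    · have := ih (h.double hx)
      rw [mirror_succ_of_lt n hx]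
      rw [abs_le] at this ⊢
      constructor <;> linarith
    · have := ih (h.double_sub_one hx)
      rw [mirror_succ_of_le n hx]
      rw [abs_le] at this ⊢
      constructor <;> linarith

/-! ### Itineraries of mirror points -/

theorem entrySign_congr {p : ℕ} {σ : ℤˣ} {x x' : ℝ} (h : x' < 1 / 2 ↔ x < 1 / 2) :
    entrySign p σ x' = entrySign p σ x := by
  simp only [entrySign, h]

/-- The entry map sends each dyadic interval of length `2⁻⁽ⁿ⁺¹⁾` affinely onto one of length `2⁻ⁿ`,
hence midpoints to midpoints. -/
theorem entryPoint_mirror {p : ℕ} {σ : ℤˣ} {x : ℝ} (h : NonDyadic x) (n : ℕ) :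
    entryPoint p σ (mirror (n + 1) x) = mirror n (entryPoint p σ x) := by
  simp only [entryPoint, mirror_succ_lt_iff h n]
  split_ifs with h1 h2 h2
  · rw [mirror_succ_of_lt n h1, mirror_one_sub (h.double h1)]; ring
  · rw [mirror_succ_of_lt n h1]; ring
  · rw [mirror_succ_of_le n (not_lt.1 h1)]; ring
  · rw [mirror_succ_of_le n (not_lt.1 h1), show 2 - 2 * x = 1 - (2 * x - 1) by ring,
      mirror_one_sub (h.double_sub_one (not_lt.1 h1))]
    ring

theorem entryPoint_one_sub {p : ℕ} {σ : ℤˣ} {x : ℝ} (h : NonDyadic x) :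
    entryPoint p σ (1 - x) = entryPoint p σ x := by
  unfold entryPoint
  rcases lt_or_gt_of_ne h.ne_half with hx | hx
  · rw [if_pos hx, if_neg (show ¬(1 - x < 1 / 2) by linarith)]; split_ifs <;> ring
  · rw [if_pos (show 1 - x < 1 / 2 by linarith), if_neg hx.not_gt]; split_ifs <;> ring

theorem entrySign_one_sub {p : ℕ} {σ : ℤˣ} {x : ℝ} (h : NonDyadic x) :
    entrySign p σ (1 - x) = -entrySign p σ x := by
  have hiff : 1 - x < 1 / 2 ↔ ¬(x < 1 / 2) := by
    rcases lt_or_gt_of_ne h.ne_half with hx | hx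
    · exact ⟨fun h => by linarith, fun h => absurd hx h⟩
    · exact ⟨fun _ => by linarith, fun _ => by linarith⟩
  simp only [entrySign, hiff]
  by_cases h1 : x < 1 / 2 <;> by_cases h2 : rightward p σ = true <;>
    simp only [h1, h2, not_true, not_false_iff, if_true, if_false, neg_neg, iff_self, iff_true,
      iff_false, Bool.false_eq_true]

/-- The path of the ball in the `n`th table until its first escape. -/
noncomputable def escapePath (p : ℕ) : ℕ → ℤˣ → ℝ → Set ℂ
  | 0, σ, x => ascentPath p σ x
  | n + 1, σ, x => ascentPath p σ x ∪
      branch (rightward p σ) '' escapePath p n (entrySign p σ x) (entryPoint p σ x)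

/-- The point of the first escape from the `n`th table. -/
noncomputable def escapePoint (p : ℕ) : ℕ → ℤˣ → ℝ → ℂ
  | 0, σ, x => branch (rightward p σ) ⟨entryPoint p σ x, 0⟩
  | n + 1, σ, x => branch (rightward p σ) (escapePoint p n (entrySign p σ x) (entryPoint p σ x))

/-- The horizontal orientation of the ball at its first escape from the `n`th table. -/
noncomputable def escapeSign (p : ℕ) : ℕ → ℤˣ → ℝ → ℤˣ
  | 0, σ, x => entrySign p σ x
  | n + 1, σ, x => escapeSign p n (entrySign p σ x) (entryPoint p σ x)

theorem branch_mem_gates₀ (b : Bool) {x : ℝ} (h0 : 0 < x) (h1 : x < 1) :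
    branch b ⟨x, 0⟩ ∈ gates₀ := by
  rw [mem_gates₀]
  simp only [branch_re, branch_im]
  refine ⟨?_, by norm_num⟩
  rcases shift_cases b with ⟨-, e⟩ | ⟨-, e⟩ <;> rw [e]
  · exact Or.inr ⟨by linarith, by linarith⟩
  · exact Or.inl ⟨by linarith, by linarith⟩

section

variable {p : ℕ} {σ : ℤˣ} {x : ℝ}

theorem escapePoint_mem_gates (h : NonDyadic x) (n : ℕ) : escapePoint p n σ x ∈ gates n := by
  induction n generalizing x σ with
  | zero => exact branch_mem_gates₀ _ (h.entryPoint p σ).1.1 (h.entryPoint p σ).1.2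
  | succ n ih => exact mem_iUnion.2 ⟨_, mem_image_of_mem _ (ih (h.entryPoint p σ))⟩

theorem escapePoint_mirror (h : NonDyadic x) (n : ℕ) :
    escapePoint p n σ (mirror n x) = escapePoint p n σ x := by
  induction n generalizing x σ with
  | zero => rw [mirror, escapePoint, entryPoint_one_sub h, escapePoint]
  | succ n ih =>
    rw [escapePoint, entrySign_congr (mirror_succ_lt_iff h n), entryPoint_mirror h,
      ih (h.entryPoint p σ), escapePoint]

/-- Above the last level both balls have equal orientations; at the last level the reflection is `u
↦ 1 - u`, which keeps the entry point and flips the orientation. -/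
theorem escapeSign_mirror (h : NonDyadic x) (n : ℕ) :
    escapeSign p n σ (mirror n x) = -escapeSign p n σ x := by
  induction n generalizing x σ with
  | zero => rw [mirror, escapeSign, entrySign_one_sub h, escapeSign]
  | succ n ih =>
    rw [escapeSign, entrySign_congr (mirror_succ_lt_iff h n), entryPoint_mirror h,
      ih (h.entryPoint p σ), escapeSign]

/-- The contractions preserve directions, so the ascent through the initial table continues, through
a gate that is now interior, with the contracted image of an ascent of the previous level. -/
theorem course_escape {lam : ℝ} (hlam : 0 < lam) (hp : Odd p) (h : NonDyadic x) (n : ℕ) :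
    Course (inside n) (horizontals n) (verticals n) (⟨x, 0⟩, heading lam p σ)
      (escapePoint p n σ x, heading lam p (escapeSign p n σ x)) (escapePath p n σ x) := by
  induction n generalizing x σ with
  | zero => exact course_ascent hlam hp h.1.1 h.1.2 h.ne_half
  | succ n ih =>
    have h' := h.entryPoint p σ
    exact .pass (course_ascent hlam hp h.1.1 h.1.2 h.ne_half).of_zero
      (gates₀_subset_inside n (branch_mem_gates₀ _ h'.1.1 h'.1.2)) ((ih h').branch _)

theorem strand_subset {a W c d U ρ : ℝ} (hW : 0 < W) {z : ℂ} (hz : z ∈ strand a W c d U ρ) :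
    a ≤ z.re ∧ z.re ≤ a + W ∧ c ≤ z.im ∧ z.im ≤ d := by
  obtain ⟨y, hy, rfl⟩ := hz
  exact ⟨by simpa using fold_nonneg W _, by simpa using fold_le hW _, hy.1, hy.2⟩

theorem ascentPath_subset : ascentPath p σ x ⊆ table₀ := by
  have hc : ∀ U ρ, strand (-1 / 2) 2 1 (3 / 2) U ρ ⊆ table₀ := by
    intro U ρ z hz
    have := strand_subset two_pos hz
    exact mem_table₀.2 (Or.inr ⟨⟨this.1, by linarith⟩, this.2.2⟩)
  refine union_subset (fun z hz => ?_) (union_subset (hc _ _) ?_)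
  · have := strand_subset one_pos hz
    exact mem_table₀.2 (Or.inl ⟨⟨this.1, by linarith⟩, this.2.2⟩)
  · split_ifs
    · exact empty_subset _
    · exact union_subset (hc _ _) (hc _ _)

theorem escapePath_subset (n : ℕ) : escapePath p n σ x ⊆ table n := by
  induction n generalizing x σ with
  | zero => rw [table_zero]; exact ascentPath_subset
  | succ n ih =>
    exact union_subset (ascentPath_subset.trans (table₀_subset_table _))
      ((image_mono ih).trans (branch_table_subset n _))

theorem escapePath_nonempty (n : ℕ) : (escapePath p n σ x).Nonempty := by
  have : (ascentPath p σ x).Nonempty := ⟨_, Or.inl ⟨0, ⟨le_rfl, zero_le_one⟩, rfl⟩⟩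
  cases n with
  | zero => exact this
  | succ n => exact this.mono subset_union_left

theorem escapePath_mono {m n : ℕ} (h : m ≤ n) : escapePath p m σ x ⊆ escapePath p n σ x := by
  induction m generalizing n x σ with
  | zero =>
    cases n with
    | zero => exact subset_rfl
    | succ n => exact subset_union_left
  | succ m ih =>
    obtain ⟨n, rfl⟩ := Nat.exists_eq_add_of_le' (Nat.one_le_of_lt h)
    exact union_subset_union_right _ (image_mono (ih (by omega)))

end

/-! ### Closeness of paths -/

/-- Every point of `S` is at distance at most `r` from a point of `T`. -/
def Near (r : ℝ) (S T : Set ℂ) : Prop := ∀ z ∈ S, ∃ w ∈ T, dist z w ≤ r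

namespace Near

variable {r : ℝ} {S S' T T' : Set ℂ}

theorem of_subset (hr : 0 ≤ r) (h : S ⊆ T) : Near r S T := fun z hz => ⟨z, h hz, by simpa using hr⟩

theorem mono {r' : ℝ} (h : Near r S T) (hr : r ≤ r') (hT : T ⊆ T') : Near r' S T' := fun z hz =>
  let ⟨w, hw, h'⟩ := h z hz
  ⟨w, hT hw, h'.trans hr⟩

theorem union (h : Near r S T) (h' : Near r S' T') : Near r (S ∪ S') (T ∪ T') := by
  rintro z (hz | hz)
  · exact (h.mono le_rfl subset_union_left) z hz
  · exact (h'.mono le_rfl subset_union_right) z hz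

theorem branch (h : Near r S T) (b : Bool) : Near (r / 2) (branch b '' S) (branch b '' T) := by
  rintro _ ⟨z, hz, rfl⟩
  obtain ⟨w, hw, h'⟩ := h z hz
  refine ⟨_, mem_image_of_mem _ hw, ?_⟩
  have : TFractal.branch b z - TFractal.branch b w = (z - w) / 2 := by
    simp only [TFractal.branch]; ring
  rw [dist_eq_norm, this, norm_div, ← dist_eq_norm, Complex.norm_ofNat]
  linarith

end Near

theorem near_strand (a W c d ρ : ℝ) (U U' : ℝ) :
    Near |U - U'| (strand a W c d U ρ) (strand a W c d U' ρ) := by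
  rintro _ ⟨y, hy, rfl⟩
  refine ⟨_, ⟨y, hy, rfl⟩, ?_⟩
  have h := abs_fold_sub_le W (U + ρ * (y - c)) (U' + ρ * (y - c))
  rw [add_sub_add_right_eq_sub] at h
  refine (Complex.dist_of_im_eq (z := ⟨a + fold W (U + ρ * (y - c)), y⟩)
    (w := ⟨a + fold W (U' + ρ * (y - c)), y⟩) rfl).trans_le ?_
  rwa [Real.dist_eq, add_sub_add_left_eq_sub]

/-- Starting points in the same half of the base give the same combinatorial type, so the strands
correspond one to one. -/
theorem near_ascentPath {p : ℕ} {σ : ℤˣ} {x x' : ℝ} (h : x' < 1 / 2 ↔ x < 1 / 2) :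
    Near |x - x'| (ascentPath p σ x) (ascentPath p σ x') := by
  have hD : Direct p σ x' ↔ Direct p σ x := by
    rw [Direct, Direct, ← not_lt, ← not_lt, h]
  have e : |x - x'| = |(3 / 2 - x) - (3 / 2 - x')| := by
    rw [abs_sub_comm]; congr 1; ring
  have e' : |x - x'| = |(3 / 2 - x - ((σ : ℤ) : ℝ) * p) - (3 / 2 - x' - ((σ : ℤ) : ℝ) * p)| := by
    rw [abs_sub_comm]; congr 1; ring
  refine Near.union (near_strand _ _ _ _ _ _ _) (Near.union ?_ ?_)
  · rw [e]; exact near_strand _ _ _ _ _ _ _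
  · by_cases hd : Direct p σ x
    · rw [if_pos hd, if_pos (hD.2 hd)]
      exact .of_subset (abs_nonneg _) subset_rfl
    · rw [if_neg hd, if_neg (hD.not.2 hd)]
      refine Near.union ?_ ?_ <;> rw [e'] <;> exact near_strand _ _ _ _ _ _ _

/-- All tables lie in one 3 by 3 box; the constant 6 in the later estimates is this crude bound,
rescaled. -/
theorem dist_le_of_mem_table {m n : ℕ} {z w : ℂ} (hz : z ∈ table m) (hw : w ∈ table n) :
    dist z w ≤ 6 := by
  have h1 := table_bounds hz
  have h2 := table_bounds hw
  rw [dist_eq_norm]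
  refine (Complex.norm_le_abs_re_add_abs_im _).trans ?_
  have h3 : |(z - w).re| ≤ 3 := by rw [abs_le]; simp; constructor <;> linarith
  have h4 : |(z - w).im| ≤ 3 := by rw [abs_le]; simp; constructor <;> linarith
  linarith

theorem near_escapePath_zero {p m : ℕ} {σ τ : ℤˣ} {x y : ℝ} :
    Near 6 (escapePath p m σ x) (escapePath p 0 τ y) := fun _ hz =>
  let ⟨w, hw⟩ := escapePath_nonempty (p := p) (σ := τ) (x := y) 0
  ⟨w, hw, dist_le_of_mem_table (escapePath_subset _ hz) (escapePath_subset _ hw)⟩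

/-- Both balls enter the same copy. The pieces before it differ by at most `|x - mirror (n + 1) x|`,
and the estimate of the previous level is halved by the contraction. -/
theorem near_escapePath_mirror {p : ℕ} {σ : ℤˣ} {x : ℝ} (h : NonDyadic x) (n : ℕ) :
    Near (6 * (1 / 2) ^ n) (escapePath p n σ x) (escapePath p n σ (mirror n x)) := by
  induction n generalizing x σ with
  | zero => simpa using near_escapePath_zero
  | succ n ih =>
    have hi := mirror_succ_lt_iff h n
    rw [escapePath, escapePath, entrySign_congr hi, entryPoint_mirror h]
    refine Near.union ((near_ascentPath hi).mono ?_ subset_rfl)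
      (((ih (h.entryPoint p σ)).branch _).mono ?_ subset_rfl)
    · rw [abs_sub_comm]
      have := abs_mirror_sub_le h (n + 1)
      have h2 : (0 : ℝ) ≤ (1 / 2) ^ (n + 1) := by positivity
      linarith
    · rw [pow_succ]; linarith

/-- The ascents coincide until the copy of scale `2⁻ⁿ`, where the crude bound on the diameter
applies. -/
theorem near_escapePath {p m n : ℕ} {σ : ℤˣ} {x : ℝ} (h : n ≤ m) :
    Near (6 * (1 / 2) ^ n) (escapePath p m σ x) (escapePath p n σ x) := by
  induction n generalizing m x σ with
  | zero => simpa using near_escapePath_zero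
  | succ n ih =>
    obtain ⟨m, rfl⟩ := Nat.exists_eq_add_of_le' (Nat.one_le_of_lt h)
    refine Near.union (.of_subset (by positivity) subset_rfl)
      (((ih (show n ≤ m by omega)).branch _).mono ?_ subset_rfl)
    rw [pow_succ]; linarith

/-! ### The orbits of the prefractal tables -/

theorem course_walls (n : ℕ) : (∀ x ∈ horizontals n, HorizontalWall (table n) x) ∧
    ∀ x ∈ verticals n, VerticalWall (table n) x :=
  ⟨fun _ => horizontals_wall, fun _ => verticals_wall⟩

theorem walls_subset_zone (n : ℕ) : horizontals n ∪ verticals n ⊆ zone :=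
  union_subset (spread_subset_zone horizontals₀_subset_zone n)
    (spread_subset_zone verticals₀_subset_zone n)

section orbits

variable {p n : ℕ} {σ : ℤˣ} {x lam : ℝ}

theorem exists_run_up (hlam : 0 < lam) (hp : Odd p) (h : NonDyadic x) :
    ∃ (k : ℕ) (y : Phase) (T : Set ℂ),
      Run (table n) (horizontals n ∪ verticals n) k (⟨x, 0⟩, heading lam p σ) y T ∧
      BilliardStep (table n) y (escapePoint p n σ x, -heading lam p (-escapeSign p n σ x)) ∧
      T ∪ segment ℝ y.1 (escapePoint p n σ x) = escapePath p n σ x := by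
  rw [← reflH_heading]
  exact (course_escape hlam hp h n).run_of_horizontalWall (inside_subset_interior n)
    (course_walls n).1 (course_walls n).2 (gates_wall (escapePoint_mem_gates h n))

theorem exists_run_down (hlam : 0 < lam) (hp : Odd p) (h : NonDyadic x) :
    ∃ (k : ℕ) (y : Phase) (T : Set ℂ),
      Run (table n) (horizontals n ∪ verticals n) k
        (escapePoint p n σ x, -heading lam p (escapeSign p n σ x)) y T ∧
      BilliardStep (table n) y (⟨x, 0⟩, heading lam p (-σ)) ∧
      T ∪ segment ℝ y.1 ⟨x, 0⟩ = escapePath p n σ x := by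
  have e : heading lam p (-σ) = reflH (-heading lam p σ) := by simp [reflH, heading]
  rw [e]
  exact (course_escape hlam hp h n).reverse.run_of_horizontalWall (inside_subset_interior n)
    (course_walls n).1 (course_walls n).2 (base_horizontalWall n h.1.1 h.1.2)

/-- The first return to the base. -/
theorem exists_run_return (hlam : 0 < lam) (hp : Odd p) (h : NonDyadic x) {W : Set ℂ}
    (hW : zone ⊆ W) (hx : (⟨mirror n x, 0⟩ : ℂ) ∈ W) :
    ∃ k, 0 < k ∧ Run (table n) W k (⟨x, 0⟩, heading lam p σ) (⟨mirror n x, 0⟩, heading lam p (-σ))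
      (escapePath p n σ x ∪ escapePath p n σ (mirror n x)) := by
  obtain ⟨k, y, T, hr, hs, hT⟩ := exists_run_up (n := n) (σ := σ) hlam hp h
  obtain ⟨k', y', T', hr', hs', hT'⟩ := exists_run_down (n := n) (σ := σ) hlam hp (h.mirror n)
  -- The reverse of the ascent from `mirror n x` starts exactly where the ascent from `x` was
  -- reflected, and in the reflected direction.
  rw [escapePoint_mirror h, escapeSign_mirror h] at hr'
  have hWs := (walls_subset_zone n).trans hW
  have h1 := (hr.mono hWs).snoc hs (hW (gates_subset_zone n (escapePoint_mem_gates h n)))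
  have h2 := (hr'.mono hWs).snoc hs' hx
  rw [hT] at h1
  rw [hT'] at h2
  exact ⟨_, by omega, h1.trans h2⟩

/-- Two round trips: the first ends at `mirror n x` with orientation `-σ`, and the second undoes
both changes because `mirror n` is an involution. -/
theorem exists_run_cycle (hlam : 0 < lam) (hp : Odd p) (h : NonDyadic x) {W : Set ℂ}
    (hW : zone ⊆ W) (hx : (⟨x, 0⟩ : ℂ) ∈ W) (hx' : (⟨mirror n x, 0⟩ : ℂ) ∈ W) :
    ∃ k, 0 < k ∧ Run (table n) W k (⟨x, 0⟩, heading lam p σ) (⟨x, 0⟩, heading lam p σ)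
      ((escapePath p n σ x ∪ escapePath p n σ (mirror n x)) ∪
        (escapePath p n (-σ) (mirror n x) ∪ escapePath p n (-σ) x)) := by
  obtain ⟨k, hk, h1⟩ := exists_run_return (σ := σ) hlam hp h hW hx'
  obtain ⟨k', hk', h2⟩ := exists_run_return (n := n) (σ := -σ) hlam hp (h.mirror n) hW
    (by rwa [mirror_mirror h])
  rw [mirror_mirror h, neg_neg] at h2
  exact ⟨_, by omega, h1.trans h2⟩

theorem inward_base (hlam : 0 < lam) (h : NonDyadic x) :
    Inward (table n) ⟨x, 0⟩ (heading lam p σ) :=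
  ((base_wall n h.1.1 h.1.2).inward_iff (smul_imCLM_ne_zero one_ne_zero) _).2
    (by simpa [heading] using hlam)

theorem exists_isOrbit (hlam : 0 < lam) (hnorm : ‖heading lam p σ‖ = 1) (hp : Odd p)
    (h : NonDyadic x) : ∃ o, IsOrbit (table n) o ∧ o 0 = (⟨x, 0⟩, heading lam p σ) := by
  obtain ⟨k, hk, hr⟩ := exists_run_cycle (n := n) (σ := σ) hlam hp h (subset_univ zone)
    (mem_univ _) (mem_univ _)
  exact hr.exists_orbit hk (base_horizontalWall n h.1.1 h.1.2).mem_frontier hnorm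
    (inward_base hlam h)

variable {o : ℕ → Phase}

theorem orbit_cycle (ho : IsOrbit (table n) o) (h0 : o 0 = (⟨x, 0⟩, heading lam p σ))
    (hlam : 0 < lam) (hp : Odd p) (h : NonDyadic x) :
    ∃ m, 0 < m ∧ Function.Periodic o m ∧
      (∀ k, (o k).1.im = 0 → (o k).1 = ⟨x, 0⟩ ∨ (o k).1 = ⟨mirror n x, 0⟩) ∧
      orbitPath o = (escapePath p n σ x ∪ escapePath p n σ (mirror n x)) ∪
        (escapePath p n (-σ) (mirror n x) ∪ escapePath p n (-σ) x) := by
  -- This `W` contains `zone`, where heights are positive, and just two points of height zero; so a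
  -- run with collisions in `W` meets the base nowhere else.
  obtain ⟨m, hm, hr⟩ := exists_run_cycle (n := n) (σ := σ) (x := x) (lam := lam) (p := p) hlam hp h
    (W := {z | z.im = 0 → z = ⟨x, 0⟩ ∨ z = ⟨mirror n x, 0⟩})
    (fun z hz h' => absurd h' hz.1.ne') (fun _ => Or.inl rfl) (fun _ => Or.inr rfl)
  rw [← h0] at hr
  obtain ⟨h1, h2, h3⟩ := hr.eq_orbit ho.2.2.2
  have hper := ho.periodic h1
  refine ⟨m, hm, hper, fun k hk => ?_, by rw [orbitPath_of_periodic hm hper, h2]⟩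
  have e : o (k % m) = o k := hper.map_mod_nat k
  rcases (k % m).eq_zero_or_pos with h' | h'
  · rw [← e, h', h0]; exact Or.inl rfl
  · rw [← e] at hk ⊢
    exact h3 _ h' (Nat.mod_lt _ hm).le hk

theorem orbit_escape (ho : IsOrbit (table n) o) (h0 : o 0 = (⟨x, 0⟩, heading lam p σ))
    (hlam : 0 < lam) (hp : Odd p) (h : NonDyadic x) :
    ∃ τ, IsFirstEscapeTime n o τ ∧ initialPath o τ = escapePath p n σ x := by
  obtain ⟨k, y, T, hr, hs, hT⟩ := exists_run_up (n := n) (σ := σ) hlam hp h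
  rw [← h0] at hr
  have h1 := (hr.mono (subset_univ _)).snoc hs (mem_univ _)
  obtain ⟨h2, h3, -⟩ := h1.eq_orbit ho.2.2.2
  refine ⟨k + 1, ⟨⟨by omega, ?_⟩, fun j hj => ?_⟩, by rw [h3, hT]⟩
  · rw [h2]; exact gates_subset_removed n (escapePoint_mem_gates h n)
  · by_contra! hlt
    rcases (hr.eq_orbit ho.2.2.2).2.2 j hj.1 (by omega) with h' | h'
    · exact Set.disjoint_left.1 (disjoint_horizontals_removed n) h' hj.2
    · exact Set.disjoint_left.1 (disjoint_verticals_removed n) h' hj.2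

theorem im_eq_zero_of_mem_side (h : NonDyadic x) {y : ℂ} (hy : y ∈ side (table n) ⟨x, 0⟩) :
    y.im = 0 := by
  have := ((base_wall n h.1.1 h.1.2).exists_segment_iff (smul_imCLM_ne_zero one_ne_zero)
    (y - ⟨x, 0⟩)).1 ⟨1, one_ne_zero, by simpa [side] using hy⟩
  simpa using this

theorem mem_side {y : ℝ} (h : NonDyadic x) (h' : NonDyadic y) :
    (⟨y, 0⟩ : ℂ) ∈ side (table n) ⟨x, 0⟩ := by
  rintro _ ⟨a, b, ha, hb, hab, rfl⟩
  have e : a • (⟨x, 0⟩ : ℂ) + b • (⟨y, 0⟩ : ℂ) = ⟨a * x + b * y, 0⟩ := by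
    apply Complex.ext <;> simp
  have hc := convex_Ioo (0 : ℝ) 1 h.1 h'.1 ha hb hab
  rw [e]
  exact (base_horizontalWall n hc.1 hc.2).mem_frontier

theorem orbit_returnTimes (ho : IsOrbit (table n) o) (h0 : o 0 = (⟨x, 0⟩, heading lam p σ))
    (hlam : 0 < lam) (hp : Odd p) (h : NonDyadic x) :
    ∃ υ, IsReturnTimes (table n) o υ ∧ ∀ j, dist (o (υ j)).1 ⟨x, 0⟩ ≤ (1 / 2) ^ n := by
  obtain ⟨m, hm, hper, hz, -⟩ := orbit_cycle ho h0 hlam hp h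
  have e : (o 0).1 = ⟨x, 0⟩ := by rw [h0]
  have h00 : (o 0).1 ∈ side (table n) (o 0).1 := by rw [e]; exact mem_side h h
  have hinf : {k | (o k).1 ∈ side (table n) (o 0).1}.Infinite := by
    refine Set.infinite_of_injective_forall_mem (f := fun j => j * m)
      (fun i j hij => Nat.eq_of_mul_eq_mul_right hm hij) fun j => ?_
    have := hper.map_mod_nat (j * m)
    rw [Nat.mul_mod_left] at this
    change (o (j * m)).1 ∈ side (table n) (o 0).1
    rw [← this]
    exact h00
  -- Time 0 satisfies the predicate, so the enumeration begins with `υ 0 = 0`.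
  refine ⟨Nat.nth fun k => (o k).1 ∈ side (table n) (o 0).1,
    ⟨Nat.nth_zero_of_zero h00, Nat.nth_strictMono hinf, fun k => ?_⟩, fun j => ?_⟩
  · rw [Nat.range_nth_of_infinite hinf]; rfl
  · have h1 := Nat.nth_mem_of_infinite hinf j
    rw [e] at h1
    rw [e]
    rcases hz _ (im_eq_zero_of_mem_side h h1) with h2 | h2
    · rw [h2, dist_self]; positivity
    · rw [h2]
      refine (Complex.dist_of_im_eq (z := ⟨mirror n x, 0⟩) (w := ⟨x, 0⟩) rfl).trans_le ?_
      rw [Real.dist_eq]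
      exact abs_mirror_sub_le h n

end orbits

/-! ### Sequences of compatible orbits -/

/-- The basepoint in `table 0` is also a boundary point of `table n`, and compatibility allows only
one boundary point on the connecting segment; so all basepoints coincide. -/
theorem IsCompatibleFrom.apply_zero {x θ : ℝ} {O : ℕ → ℕ → Phase} (h : IsCompatibleFrom x θ O)
    (hx : NonDyadic x) (n : ℕ) : O n 0 = (⟨x, 0⟩, ⟨Real.cos θ, Real.sin θ⟩) := by
  rcases n.eq_zero_or_pos with rfl | hn
  · exact h.2
  · obtain ⟨h1, -, h3⟩ := h.1.2 0 n hn
    have h4 : (O 0 0).1 ∈ segment ℝ (O n 0).1 (O 0 0).1 ∩ frontier (table n) := by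
      refine ⟨right_mem_segment .., ?_⟩
      rw [h.2]
      exact (base_horizontalWall n hx.1.1 hx.1.2).mem_frontier
    rw [h3, mem_singleton_iff] at h4
    rw [← h.2]
    exact Prod.ext h4.symm h1.symm

theorem existsUnique_isCompatibleFrom {p : ℕ} {x θ lam : ℝ} {σ : ℤˣ} (hlam : 0 < lam)
    (hp : Odd p) (h : NonDyadic x)
    (hθ : (⟨Real.cos θ, Real.sin θ⟩ : ℂ) = heading lam p σ) : ∃! O, IsCompatibleFrom x θ O := by
  have hnorm : ‖heading lam p σ‖ = 1 := by
    rw [← hθ, Complex.norm_eq_sqrt_sq_add_sq]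
    simp
  choose O hO hO0 using fun n => exists_isOrbit (n := n) hlam hnorm hp h
  refine ⟨O, ⟨⟨hO, fun m n _ => ?_⟩, by rw [hO0, hθ]⟩, fun O' hO' => ?_⟩
  · rw [hO0, hO0]
    refine ⟨rfl, ⟨0, le_rfl, by simp⟩, ?_⟩
    rw [segment_same, inter_eq_left, singleton_subset_iff]
    exact (base_horizontalWall n h.1.1 h.1.2).mem_frontier
  · funext n
    exact (hO'.1.1 n).unique (hO n) (by rw [hO'.apply_zero h, hO0, hθ])

/-! ### Convergence of the paths -/

theorem exists_near_of_mem_closure {p : ℕ} {σ : ℤˣ} {x : ℝ} (n : ℕ) {z : ℂ}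
    (hz : z ∈ closure (⋃ m, escapePath p m σ x)) :
    ∃ w ∈ escapePath p n σ x, dist z w ≤ 7 * (1 / 2) ^ n := by
  -- The constant is `7 = 1 + 6`: one unit for the closure, six for the ascents of higher level.
  obtain ⟨y, hy, hzy⟩ := Metric.mem_closure_iff.1 hz ((1 / 2) ^ n) (by positivity)
  obtain ⟨m, hy⟩ := mem_iUnion.1 hy
  obtain ⟨w, hw, hyw⟩ := near_escapePath (le_max_right m n) y (escapePath_mono (le_max_left m n) hy)
  exact ⟨w, hw, (dist_triangle z y w).trans (by linarith)⟩

theorem tendsto_const_mul_half_pow (c : ℝ) :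
    Tendsto (fun n : ℕ => c * (1 / 2 : ℝ) ^ n) atTop (𝓝 0) := by
  simpa using (tendsto_pow_atTop_nhds_zero_of_lt_one (r := (1 / 2 : ℝ)) (by norm_num)
    (by norm_num)).const_mul c

theorem hausdorffEDist_cycle_le {p : ℕ} {σ : ℤˣ} {x : ℝ} (h : NonDyadic x) (n : ℕ) :
    Metric.hausdorffEDist ((escapePath p n σ x ∪ escapePath p n σ (mirror n x)) ∪
        (escapePath p n (-σ) (mirror n x) ∪ escapePath p n (-σ) x))
      (closure (⋃ m, escapePath p m σ x) ∪ closure (⋃ m, escapePath p m (-σ) x)) ≤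
      ENNReal.ofReal (7 * (1 / 2) ^ n) := by
  have h6 : (6 : ℝ) * (1 / 2) ^ n ≤ 7 * (1 / 2) ^ n := by gcongr; norm_num
  have hsub : ∀ τ : ℤˣ, escapePath p n τ x ⊆ closure (⋃ m, escapePath p m τ x) := fun τ =>
    (subset_iUnion (fun m => escapePath p m τ x) n).trans subset_closure
  have hm : ∀ τ : ℤˣ, Near (7 * (1 / 2) ^ n) (escapePath p n τ (mirror n x))
      (closure (⋃ m, escapePath p m τ x)) := by
    intro τ
    have := near_escapePath_mirror (p := p) (σ := τ) (h.mirror n) n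
    rw [mirror_mirror h] at this
    exact this.mono h6 (hsub τ)
  refine Metric.hausdorffEDist_le_of_mem_edist ?_ ?_
  -- Each closure is repeated so that the four ascents can be matched one by one.
  · have key : Near (7 * (1 / 2) ^ n) ((escapePath p n σ x ∪ escapePath p n σ (mirror n x)) ∪
        (escapePath p n (-σ) (mirror n x) ∪ escapePath p n (-σ) x))
        ((closure (⋃ m, escapePath p m σ x) ∪ closure (⋃ m, escapePath p m σ x)) ∪
          (closure (⋃ m, escapePath p m (-σ) x) ∪ closure (⋃ m, escapePath p m (-σ) x))) :=
      ((Near.of_subset (by positivity) (hsub σ)).union (hm σ)).union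
        ((hm (-σ)).union (Near.of_subset (by positivity) (hsub (-σ))))
    rw [union_self, union_self] at key
    intro z hz
    obtain ⟨w, hw, hzw⟩ := key z hz
    exact ⟨w, hw, by rw [edist_dist]; exact ENNReal.ofReal_le_ofReal hzw⟩
  · rintro z (hz | hz)
    · obtain ⟨w, hw, hzw⟩ := exists_near_of_mem_closure n hz
      exact ⟨w, Or.inl (Or.inl hw), by rw [edist_dist]; exact ENNReal.ofReal_le_ofReal hzw⟩
    · obtain ⟨w, hw, hzw⟩ := exists_near_of_mem_closure n hz
      exact ⟨w, Or.inr (Or.inr hw), by rw [edist_dist]; exact ENNReal.ofReal_le_ofReal hzw⟩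

theorem IsCompatibleFrom.isRecurrentWith {p : ℕ} {x θ lam : ℝ} {σ : ℤˣ} {O : ℕ → ℕ → Phase}
    (hO : IsCompatibleFrom x θ O) (hlam : 0 < lam) (hp : Odd p) (h : NonDyadic x)
    (hθ : (⟨Real.cos θ, Real.sin θ⟩ : ℂ) = heading lam p σ) :
    IsRecurrentWith O fun _ => ⟨x, 0⟩ := by
  have h0 : ∀ n, O n 0 = (⟨x, 0⟩, heading lam p σ) := fun n => by rw [hO.apply_zero h, hθ]
  choose υ hυ hd using fun n => orbit_returnTimes (hO.1.1 n) (h0 n) hlam hp h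
  refine ⟨hO.1, fun n => by rw [h0, h0], υ, hυ, fun j _ => ⟨?_, ?_⟩⟩
  · rw [h0]; exact mem_side h h
  · rw [tendsto_iff_dist_tendsto_zero]
    refine squeeze_zero (fun _ => dist_nonneg) (fun n => hd n j) ?_
    simpa only [one_mul] using tendsto_const_mul_half_pow 1

theorem IsCompatibleFrom.isNontrivialPath {p : ℕ} {x θ lam : ℝ} {σ : ℤˣ} {O : ℕ → ℕ → Phase}
    (hO : IsCompatibleFrom x θ O) (hlam : 0 < lam) (hp : Odd p) (h : NonDyadic x)
    (hθ : (⟨Real.cos θ, Real.sin θ⟩ : ℂ) = heading lam p σ) :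
    IsNontrivialPath O (closure (⋃ n, escapePath p n σ x)) := by
  choose τ hτ hτ' using fun n => orbit_escape (hO.1.1 n)
    (show O n 0 = (⟨x, 0⟩, heading lam p σ) by rw [hO.apply_zero h, hθ]) hlam hp h
  exact ⟨hO.1, τ, hτ, by simp only [hτ']⟩

end TFractal

/-! ### The theorem -/

open TFractal in
theorem mainTheorem8 (p : ℕ) (hp : Odd p) (x₀ : ℝ) (hx₀ : x₀ ∈ Set.Icc (0 : ℝ) 1)
    (hdyadic : ∀ m l : ℕ, x₀ ≠ (m : ℝ) / 2 ^ l)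
    (θ₀ : ℝ) (hθ₀ : θ₀ ∈ Set.Ioo 0 Real.pi) (htan : Real.tan θ₀ = 1 / (p : ℝ)) :
    (∃! O : ℕ → ℕ → TFractal.Phase, TFractal.IsCompatibleFrom x₀ θ₀ O) ∧
    (∃! O' : ℕ → ℕ → TFractal.Phase, TFractal.IsCompatibleFrom x₀ (Real.pi - θ₀) O') ∧
    ∀ O O' : ℕ → ℕ → TFractal.Phase,
      TFractal.IsCompatibleFrom x₀ θ₀ O → TFractal.IsCompatibleFrom x₀ (Real.pi - θ₀) O' →
      (∀ n, TFractal.IsPeriodicOrbit (O n)) ∧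
      TFractal.IsPeriodicFractalOrbit O ∧
      TFractal.IsRecurrentWith O (fun _ => (⟨x₀, 0⟩ : ℂ)) ∧
      ∃ N N' : Set ℂ, TFractal.IsNontrivialPath O N ∧ TFractal.IsNontrivialPath O' N' ∧
        N ∪ N' ⊆ TFractal.fractalTable ∧
        Filter.Tendsto (fun n => Metric.hausdorffEDist (TFractal.orbitPath (O n)) (N ∪ N'))
          Filter.atTop (nhds 0) := by
  have hx : NonDyadic x₀ := by
    refine ⟨⟨lt_of_le_of_ne hx₀.1 fun h => hdyadic 0 0 (by simp [← h]),
      lt_of_le_of_ne hx₀.2 fun h => hdyadic 1 0 (by simp [h])⟩, fun m l hm => ?_⟩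
    -- The hypothesis excludes only natural numerators; negative ones are impossible because `x₀ ≥
    -- 0`.
    have hm0 : 0 ≤ m := by
      have : (0 : ℝ) ≤ m := by rw [← hm]; exact mul_nonneg hx₀.1 (by positivity)
      exact_mod_cast this
    obtain ⟨k, rfl⟩ := Int.eq_ofNat_of_zero_le hm0
    exact hdyadic k l (by rw [eq_div_iff (by positivity), hm]; simp)
  have hlam : 0 < Real.sin θ₀ := Real.sin_pos_of_mem_Ioo hθ₀
  have hp0 : (0 : ℝ) < p := by exact_mod_cast hp.pos
  have hcos : Real.cos θ₀ = Real.sin θ₀ * p := by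
    have hc : Real.cos θ₀ ≠ 0 := by
      intro hc
      rw [Real.tan_eq_sin_div_cos, hc, div_zero] at htan
      exact (one_div_pos.2 hp0).ne htan
    rw [Real.tan_eq_sin_div_cos, div_eq_div_iff hc hp0.ne', one_mul] at htan
    exact htan.symm
  -- Since `cos θ₀ = p * sin θ₀`, the angles `θ₀` and `π - θ₀` are the two orientations `1` and `-1`
  -- of the same inverse slope `p`.
  have e₁ : (⟨Real.cos θ₀, Real.sin θ₀⟩ : ℂ) = heading (Real.sin θ₀) p 1 := by
    simp [heading, hcos]
  have e₂ : (⟨Real.cos (Real.pi - θ₀), Real.sin (Real.pi - θ₀)⟩ : ℂ) =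
      heading (Real.sin θ₀) p (-1) := by
    simp [heading, hcos]
  refine ⟨existsUnique_isCompatibleFrom hlam hp hx e₁, existsUnique_isCompatibleFrom hlam hp hx e₂,
    fun O O' hO hO' => ?_⟩
  have h0 : ∀ n, O n 0 = (⟨x₀, 0⟩, heading (Real.sin θ₀) p 1) := fun n => by
    rw [hO.apply_zero hx, e₁]
  have hrec := hO.isRecurrentWith hlam hp hx e₁
  refine ⟨fun n => ?_, ⟨_, hrec, 1, one_pos, fun _ _ => rfl⟩, hrec, _, _,
    hO.isNontrivialPath hlam hp hx e₁, hO'.isNontrivialPath hlam hp hx e₂, ?_, ?_⟩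
  · obtain ⟨m, hm, hper, -⟩ := orbit_cycle (hO.1.1 n) (h0 n) hlam hp hx
    exact ⟨m, hm, hper⟩
  · exact union_subset (closure_mono (iUnion_mono fun n => escapePath_subset n))
      (closure_mono (iUnion_mono fun n => escapePath_subset n))
  · refine tendsto_of_tendsto_of_tendsto_of_le_of_le tendsto_const_nhds
      (h := fun n : ℕ => ENNReal.ofReal (7 * (1 / 2) ^ n)) ?_ (fun _ => zero_le) fun n => ?_
    · simpa using ENNReal.tendsto_ofReal (tendsto_const_mul_half_pow 7)
    · obtain ⟨-, -, -, -, hpath⟩ := orbit_cycle (hO.1.1 n) (h0 n) hlam hp hx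
      rw [hpath]
      exact hausdorffEDist_cycle_le hx n
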